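/- Let $N\in\mathbb{N}$ and let $L^2(\mathbb{R}^N)$ be the Hilbert space of an $N$-mode field. For $\mathbf{x}=(q_1,p_1,\dots,q_N,p_N)^T\in\mathbb{R}^{2N}$ let $W(\mathbf{x})=e^{-i\mathbf{x}^T\mathbf{\Omega}\mathbf{R}}$ be the Weyl operator, where $\mathbf{R}=(Q_1,P_1,\dots,Q_N,P_N)^T$ are the canonical position and momentum operators and $\mathbf{\Omega}=\bigoplus_{j=1}^N\begin{pmatrix}0&1\\-1&0\end{pmatrix}$; explicitly, $(W(\mathbf{x})f)(t)=e^{-\frac i2 q\cdot p}e^{ip\cdot t}f(t-q)$. A state is a positive trace-one operator, and an observable with outcomes in $\mathbb{R}^M$ is a normalized positive operator valued measure $\mathsf{E}$ on the Borel sets of $\mathbb{R}^M$, countably additive in the weak operator topology. It is Gaussian with parameters $(\mathbf{A}_0,\mathbf{B}_0,\mathbf{v}_0)$, where $\mathbf{A}_0$ is a real $2N\times M$ matrix, $\mathbf{B}_0$ a real $M\times M$ matrix with $\mathbf{B}_0-i\mathbf{A}_0^T\mathbf{\Omega}\mathbf{A}_0\ge 0$, and $\mathbf{v}_0\in\mathbb{R}^M$,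 if for all $\mathbf{p}\in\mathbb{R}^M$ $$\int e^{i\mathbf{p}^T\mathbf{x}}\,\mathsf{E}(d\mathbf{x})=e^{-\frac14\mathbf{p}^T\mathbf{B}_0\mathbf{p}-i\mathbf{v}_0^T\mathbf{p}}\,W(\mathbf{A}_0\mathbf{p}).$$ A family $(\mathsf{E}_j)_{j\in\mathcal I}$ of observables is informationally complete if any two states $\rho,\sigma$ with $\operatorname{tr}(\rho\,\mathsf{E}_j(X))=\operatorname{tr}(\sigma\,\mathsf{E}_j(X))$ for all $j$ and all Borel sets $X$ are equal. (1) Let $\mathsf{E}_j$, $j\in\mathcal I$, be an arbitrary family of Gaussian observables with one-dimensional outcome space ($M=1$), so that the matrices $\mathbf{A}_0^j$ are vectors in $\mathbb{R}^{2N}$. Then $\{\mathsf{E}_j\mid j\in\mathcal I\}$ is informationally complete if and only if the set $$\{\epsilon\,\mathbf{A}_0^j/\|\mathbf{A}_0^j\| \;\mid\; j\in\mathcal I,\ \mathbf{A}_0^j\neq 0,\ \epsilon=\pm1\}$$ is dense in the unit sphere of $\mathbb{R}^{2N}$ (with the Euclidean norm). (2) Let $N=1$. For every $\theta\in\mathbb{R}$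 there is a Gaussian observable $\mathsf{Q}_\theta$ with parameters $\mathbf{A}_0=(-\sin\theta,\cos\theta)^T$, $\mathbf{B}_0=0$, $\mathbf{v}_0=0$ (the rotated quadrature, i.e. the spectral measure of $\cos\theta\,Q+\sin\theta\,P$). For $\mathcal I\subset[0,\pi)$ the set $\{\mathsf{Q}_\theta\mid\theta\in\mathcal I\}$ is informationally complete if and only if $\mathcal I$ is dense in $[0,\pi)$. -/

import Mathlib

open MeasureTheory

noncomputable section

namespace GaussianObs

section Operators

variable {H : Type*} [NormedAddCommGroup H] [InnerProductSpace ℂ H] [CompleteSpace H]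

variable (H) in
/-- The index set of a fixed orthonormal basis of `H`. -/
def BasisIndex : Set H := (exists_hilbertBasis ℂ H).choose

variable (H) in
/-- A fixed orthonormal basis of `H`. -/
def basis : HilbertBasis (BasisIndex H) ℂ H := (exists_hilbertBasis ℂ H).choose_spec.choose

/-- The trace `∑ᵢ ⟨eᵢ, T eᵢ⟩`. For trace class operators (the only ones it is applied to) the series
converges absolutely and its sum does not depend on the orthonormal basis. -/
def trace (T : H →L[ℂ] H) : ℂ := ∑' i, inner ℂ (basis H i) (T (basis H i))

variable (H) in
/-- A state (density operator): a positive operator whose trace is one. -/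
structure State where
  op : H →L[ℂ] H
  pos : op.IsPositive
  trace_one : HasSum (fun i => inner ℂ (basis H i) (op (basis H i))) 1

variable (H) in
/-- An observable with outcomes in `Ω`: a normalized positive operator valued measure. The
values `E X` at non-measurable `X` are irrelevant. Countable additivity is in the weak operator
topology. -/
structure POVM (Ω : Type*) [MeasurableSpace Ω] where
  toFun : Set Ω → (H →L[ℂ] H)
  pos : ∀ X, MeasurableSet X → (toFun X).IsPositive
  univ : toFun Set.univ = 1
  sigma_additive : ∀ X : ℕ → Set Ω, (∀ n, MeasurableSet (X n)) →
    Pairwise (fun m n => Disjoint (X m) (X n)) →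
    ∀ φ ψ : H, HasSum (fun n => inner ℂ φ (toFun (X n) ψ)) (inner ℂ φ (toFun (⋃ n, X n) ψ))

variable {Ω : Type*} [MeasurableSpace Ω]

/-- The outcome statistics `X ↦ tr (ρ E(X))`. -/
def outcomeProb (ρ : State H) (E : POVM H Ω) (X : Set Ω) : ℂ := trace (ρ.op * E.toFun X)

/-- A family of observables is informationally complete if every state is determined by the
collective measurement outcome statistics. -/
def InformationallyComplete {ι : Type*} (E : ι → POVM H Ω) : Prop :=
  ∀ ρ σ : State H,
    (∀ j, ∀ X, MeasurableSet X → outcomeProb ρ (E j) X = outcomeProb σ (E j) X) → ρ = σ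

theorem POVM.empty (E : POVM H Ω) (φ ψ : H) : inner ℂ φ (E.toFun ∅ ψ) = 0 := by
  have h := E.sigma_additive (fun _ => ∅) (fun _ => MeasurableSet.empty)
    (fun _ _ _ => disjoint_bot_left) φ ψ
  have h0 := h.summable.tendsto_atTop_zero
  exact tendsto_nhds_unique tendsto_const_nhds h0

/-- The finite positive measure `X ↦ ⟨ψ, E(X) ψ⟩`. -/
def POVM.diagMeasure (E : POVM H Ω) (ψ : H) : Measure Ω :=
  Measure.ofMeasurable (fun X _ => ENNReal.ofReal (inner ℂ ψ (E.toFun X ψ)).re)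
    (by simp [E.empty])
    (by
      intro X hX hd
      have h := Complex.hasSum_re (E.sigma_additive X hX hd ψ ψ)
      rw [← h.tsum_eq, ENNReal.ofReal_tsum_of_nonneg _ h.summable]
      exact fun n => (E.pos _ (hX n)).re_inner_nonneg_right ψ)

end Operators

section CharacteristicFunction

variable {H : Type*} [NormedAddCommGroup H] [InnerProductSpace ℂ H] [CompleteSpace H]
variable {Ω : Type*} [NormedAddCommGroup Ω] [InnerProductSpace ℝ Ω] [MeasurableSpace Ω]

/-- `T` is the value `∫ exp(i⟨p,x⟩) E(dx)` at `p` of the characteristic function of the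
observable `E`. The operator integral is weak, and by polarization it is enough to test it on the
diagonal: `⟨ψ, T ψ⟩ = ∫ exp(i⟨p,x⟩) ⟨ψ, E(dx) ψ⟩` for all `ψ`. -/
def POVM.HasCharOp (E : POVM H Ω) (p : Ω) (T : H →L[ℂ] H) : Prop :=
  ∀ ψ : H, inner ℂ ψ (T ψ) = charFun (E.diagMeasure ψ) p

end CharacteristicFunction

section Weyl

variable (N : ℕ)

/-- The Hilbert space `L²(ℝᴺ)` of an `N`-mode field in the coordinate representation. -/
abbrev FieldSpace : Type := Lp ℂ 2 (volume : Measure (EuclideanSpace ℝ (Fin N)))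

/-- The phase space `ℝ²ᴺ` with its Euclidean norm. The coordinates, listed lexicographically, are
`(q₁, p₁, …, q_N, p_N)`: the entry `(j, 0)` is `q_j` and the entry `(j, 1)` is `p_j`. -/
abbrev PhaseSpace : Type := EuclideanSpace ℝ (Fin N × Fin 2)

/-- The symplectic matrix `Ω`, a direct sum of `N` blocks `!![0, 1; -1, 0]`. -/
def symplecticMatrix : Matrix (Fin N × Fin 2) (Fin N × Fin 2) ℝ :=
  Matrix.of fun k l => if k.1 = l.1 then !![0, 1; -1, 0] k.2 l.2 else 0

variable {N}

/-- The position part of a phase space point. -/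
def PhaseSpace.q (x : PhaseSpace N) : EuclideanSpace ℝ (Fin N) := WithLp.toLp 2 fun j => x (j, 0)

/-- The momentum part of a phase space point. -/
def PhaseSpace.p (x : PhaseSpace N) : EuclideanSpace ℝ (Fin N) := WithLp.toLp 2 fun j => x (j, 1)

/-- The plane wave `t ↦ exp(i p·t)`. -/
def wave (p t : EuclideanSpace ℝ (Fin N)) : ℂ := Complex.exp (Complex.I * (inner ℝ p t : ℝ))

theorem norm_wave (p t : EuclideanSpace ℝ (Fin N)) : ‖wave p t‖ = 1 := by
  rw [wave, mul_comm, Complex.norm_exp_ofReal_mul_I]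

theorem memLp_wave_mul (p : EuclideanSpace ℝ (Fin N)) (f : FieldSpace N) :
    MemLp (fun t => wave p t * f t) 2 volume := by
  refine (Lp.memLp f).of_le (AEStronglyMeasurable.mul ?_ (Lp.aestronglyMeasurable f)) ?_
  · have : Continuous (wave p) := by unfold wave; fun_prop
    exact this.aestronglyMeasurable
  · exact Filter.Eventually.of_forall fun t => by rw [norm_mul, norm_wave, one_mul]

/-- The operator `exp(i p·Q)`, i.e. `(exp(i p·Q) f)(t) = exp(i p·t) f(t)`. -/
def boost (p : EuclideanSpace ℝ (Fin N)) : FieldSpace N →L[ℂ] FieldSpace N :=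
  LinearMap.mkContinuous
    { toFun := fun f => (memLp_wave_mul p f).toLp _
      map_add' := by
        intro f g
        rw [← MemLp.toLp_add]
        refine MemLp.toLp_congr _ _ ?_
        filter_upwards [Lp.coeFn_add f g] with t ht
        simp only [ht, Pi.add_apply, mul_add]
      map_smul' := by
        intro c f
        rw [RingHom.id_apply, ← MemLp.toLp_const_smul]
        refine MemLp.toLp_congr _ _ ?_
        filter_upwards [Lp.coeFn_smul c f] with t ht
        simp only [ht, Pi.smul_apply, smul_eq_mul, mul_left_comm] }
    1
    (by
      intro f
      rw [one_mul]
      refine Lp.norm_le_norm_of_ae_le ?_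
      filter_upwards [(memLp_wave_mul p f).coeFn_toLp] with t ht
      simp only [LinearMap.coe_mk, AddHom.coe_mk]
      rw [ht, norm_mul, norm_wave, one_mul])

/-- The operator `exp(-i q·P)`, i.e. `(exp(-i q·P) f)(t) = f(t - q)`. -/
def shift (q : EuclideanSpace ℝ (Fin N)) : FieldSpace N →L[ℂ] FieldSpace N :=
  (Lp.compMeasurePreservingₗᵢ ℂ (fun t => t - q)
    (measurePreserving_sub_right volume q)).toContinuousLinearMap

/-- The Weyl operator `W(x) = exp(-i xᵀΩR) = exp(i (p·Q - q·P))` at `x = (q, p)`, where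
`R = (Q₁, P₁, …, Q_N, P_N)`. In the coordinate representation it acts by
`(W(q, p) f)(t) = exp(-i q·p / 2) exp(i p·t) f(t - q)`. -/
def weyl (x : PhaseSpace N) : FieldSpace N →L[ℂ] FieldSpace N :=
  Complex.exp (-(Complex.I / 2) * (inner ℝ x.q x.p : ℝ)) • (boost x.p * shift x.q)

end Weyl

open scoped ComplexOrder in
/-- `E` is a Gaussian observable with outcome space `ℝᴹ` and parameters `(A, B, v)`: the positivity
condition `B - i AᵀΩA ≥ 0` holds, and for all `p` the characteristic function of `E` at `p` is
`exp(-pᵀBp / 4 - i vᵀp) W(A p)`. -/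
structure IsGaussian {N M : ℕ} (E : POVM (FieldSpace N) (EuclideanSpace ℝ (Fin M)))
    (A : Matrix (Fin N × Fin 2) (Fin M) ℝ) (B : Matrix (Fin M) (Fin M) ℝ)
    (v : EuclideanSpace ℝ (Fin M)) : Prop where
  posSemidef : (B.map (fun r => (r : ℂ))
    - Complex.I • (A.transpose * symplecticMatrix N * A).map (fun r => (r : ℂ))).PosSemidef
  charOp : ∀ p : EuclideanSpace ℝ (Fin M), E.HasCharOp p
    (Complex.exp (-(1 / 4) * (dotProduct p.ofLp (B.mulVec p.ofLp) : ℝ)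
        - Complex.I * (dotProduct v.ofLp p.ofLp : ℝ)) •
      weyl (WithLp.toLp 2 (A.mulVec p.ofLp)))

/-- A vector of `ℝ²ᴺ` as a matrix with one column. -/
def colMatrix {N : ℕ} (a : PhaseSpace N) : Matrix (Fin N × Fin 2) (Fin 1) ℝ :=
  Matrix.of fun k _ => a k

/-- The phase space vector `(-sin θ, cos θ)` of a single mode. -/
def quadratureVector (θ : ℝ) : PhaseSpace 1 :=
  WithLp.toLp 2 fun k => ![-Real.sin θ, Real.cos θ] k.2

/-- `E` is the rotated quadrature observable `Q_θ`, the sharp unbiased Gaussian observable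
of a single mode whose characteristic function is
`p ↦ W(p (-sin θ, cos θ)) = exp(i p (cos θ Q + sin θ P))`. -/
def IsRotatedQuadrature (θ : ℝ) (E : POVM (FieldSpace 1) (EuclideanSpace ℝ (Fin 1))) : Prop :=
  IsGaussian E (colMatrix (quadratureVector θ)) 0 0

end GaussianObs

end

open GaussianObs

open MeasureTheory

noncomputable section

/-! For a one-dimensional outcome space, the characteristic function of the outcome distribution at
`s` is a nowhere vanishing scalar times `tr (ρ W(s a))`. The observable therefore reveals exactly
the restriction of the Weyl characteristic function `ρ.weylChar` to the line through `a`; noise and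
offset play no role (`outcomeProb_eq_iff_weylChar_eq`).

Dense directions suffice because `ρ.weylChar` is continuous and determines `ρ`
(`State.weylChar_injective`).

They are necessary because `weylChar` can be changed locally. If a direction `u₀` is not
approximated, a ball around `u₀` avoids the origin and all the lines. A bump in that ball has a
hermitian part that vanishes on every line and at the origin, so its inverse Fourier transform is a
real function of integral zero. The normalized positive and negative parts are two probability
measures (`exists_probabilityMeasure_pair`). Mixing phase space translates of a Gaussian wave
function with them multiplies its never vanishing characteristic function by the Fourier transforms
of the measures. The two resulting states are distinct but agree on all the lines
(`exists_state_pair`).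

A rotated quadrature is obtained by diagonalizing its Weyl operators: they are already
multiplication operators when `sin θ = 0`, and otherwise become so after a chirp followed by the
Fourier transform. Since `θ + π` only changes the sign of the direction, density on the circle up to
sign is density of angles in `[0, π)`. -/

namespace GaussianObs

/-! ### Traces against a state through its square root -/

section Trace

theorem hasSum_of_eq {ι : Type*} {f g : ι → ℂ} {a : ℂ} (h : HasSum g a) (hfg : ∀ i, f i = g i) :
    HasSum f a := (funext hfg : f = g) ▸ h

theorem hasSum_norm_inner_sq {H ι : Type*} [NormedAddCommGroup H] [InnerProductSpace ℂ H]
    (b : HilbertBasis ι ℂ H) (x : H) :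
    HasSum (fun i => ‖inner ℂ (b i) x‖ ^ 2) (‖x‖ ^ 2) := by
  have h := Complex.hasSum_re (b.hasSum_inner_mul_inner x x)
  rw [inner_self_eq_norm_sq_to_K] at h
  convert h using 1
  · ext i
    rw [← inner_conj_symm x (b i), ← Complex.normSq_eq_conj_mul_self, Complex.ofReal_re,
      Complex.normSq_eq_norm_sq]
  · norm_cast

variable {H : Type*} [NormedAddCommGroup H] [InnerProductSpace ℂ H] [CompleteSpace H]

theorem summable_prod_norm_inner_sq {ι κ : Type*} (b : HilbertBasis ι ℂ H) {v : κ → H}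
    (hv : Summable fun k => ‖v k‖ ^ 2) :
    Summable fun kj : κ × ι => ‖inner ℂ (b kj.2) (v kj.1)‖ ^ 2 := by
  have hnn : 0 ≤ fun kj : κ × ι => ‖inner ℂ (b kj.2) (v kj.1)‖ ^ 2 := fun _ => sq_nonneg _
  refine (summable_prod_of_nonneg hnn).2 ⟨fun k => (hasSum_norm_inner_sq b (v k)).summable, ?_⟩
  exact hv.congr fun k => (hasSum_norm_inner_sq b (v k)).tsum_eq.symm

/-- Parseval's identity, summed over two square summable families. -/
theorem summable_prod_inner_mul_inner {ι κ : Type*} (b : HilbertBasis ι ℂ H) {u v : κ → H}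
    (hu : Summable fun k => ‖u k‖ ^ 2) (hv : Summable fun k => ‖v k‖ ^ 2) :
    Summable fun kj : κ × ι => inner ℂ (u kj.1) (b kj.2) * inner ℂ (b kj.2) (v kj.1) := by
  refine Summable.of_norm_bounded
    ((summable_prod_norm_inner_sq b hu).add (summable_prod_norm_inner_sq b hv)) fun kj => ?_
  rw [norm_mul, norm_inner_symm (u kj.1)]
  generalize ‖inner ℂ (b kj.2) (u kj.1)‖ = x
  generalize ‖inner ℂ (b kj.2) (v kj.1)‖ = y
  nlinarith [sq_nonneg (x - y), sq_nonneg (x + y)]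

/-- Cyclicity of the trace of `S S B` for a Hilbert-Schmidt operator `S`. -/
theorem hasSum_inner_sq_mul {ι : Type*} (b : HilbertBasis ι ℂ H) {S : H →L[ℂ] H}
    (hadj : ∀ x y, inner ℂ (S x) y = inner ℂ x (S y))
    (hsum : Summable fun i => ‖S (b i)‖ ^ 2) (B : H →L[ℂ] H) :
    HasSum (fun i => inner ℂ (b i) (S (S (B (b i))))) (∑' i, inner ℂ (S (b i)) (B (S (b i)))) := by
  obtain ⟨C, hC⟩ : ∃ C : H →L[ℂ] H, ∀ x y, inner ℂ (C x) y = inner ℂ x (B y) :=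
    ⟨ContinuousLinearMap.adjoint B, fun x y => ContinuousLinearMap.adjoint_inner_left B y x⟩
  have hCsum : Summable fun i => ‖C (S (b i))‖ ^ 2 := by
    refine Summable.of_nonneg_of_le (fun _ => by positivity) (fun i => ?_)
      (hsum.mul_left (‖C‖ ^ 2))
    rw [← mul_pow]
    gcongr
    exact C.le_opNorm _
  -- The double series converges absolutely, so it may be summed in either order: rows give the
  -- right side, columns the left.
  have hF := summable_prod_inner_mul_inner b hCsum hsum
  have hrow (i : ι) : HasSum (fun j => inner ℂ (C (S (b i))) (b j) * inner ℂ (b j) (S (b i)))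
      (inner ℂ (S (b i)) (B (S (b i)))) := by
    simpa only [hC] using b.hasSum_inner_mul_inner (C (S (b i))) (S (b i))
  have hcol (j : ι) : HasSum (fun i => inner ℂ (C (S (b i))) (b j) * inner ℂ (b j) (S (b i)))
      (inner ℂ (b j) (S (S (B (b j))))) := by
    have h := b.hasSum_inner_mul_inner (S (b j)) (S (B (b j)))
    rw [hadj] at h
    refine hasSum_of_eq h fun i => ?_
    rw [hC, hadj, hadj, mul_comm]
  have h1 : (∑' i, inner ℂ (S (b i)) (B (S (b i)))) =
      ∑' ij : ι × ι, inner ℂ (C (S (b ij.1))) (b ij.2) * inner ℂ (b ij.2) (S (b ij.1)) := by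
    rw [hF.tsum_prod]
    exact tsum_congr fun i => (hrow i).tsum_eq.symm
  rw [h1, ← (Equiv.prodComm ι ι).tsum_eq]
  exact hF.prod_symm.hasSum.prod_fiberwise hcol

/-- The image of the `i`-th basis vector under the square root of the state `ρ`. -/
def State.vec (ρ : State H) (i : BasisIndex H) : H := CFC.sqrt ρ.op (basis H i)

theorem State.sqrt_isSelfAdjoint (ρ : State H) : IsSelfAdjoint (CFC.sqrt ρ.op) :=
  (CFC.sqrt_nonneg ρ.op).isSelfAdjoint

theorem State.sqrt_sqrt (ρ : State H) (x : H) : CFC.sqrt ρ.op (CFC.sqrt ρ.op x) = ρ.op x := by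
  have h : (0 : H →L[ℂ] H) ≤ ρ.op := (ContinuousLinearMap.nonneg_iff_isPositive _).2 ρ.pos
  exact congrArg (fun T : H →L[ℂ] H => T x) (CFC.sqrt_mul_sqrt_self ρ.op h)

theorem State.inner_sqrt (ρ : State H) (x y : H) :
    inner ℂ (CFC.sqrt ρ.op x) y = inner ℂ x (CFC.sqrt ρ.op y) := by
  rw [← ContinuousLinearMap.adjoint_inner_right, ρ.sqrt_isSelfAdjoint.adjoint_eq]

theorem State.hasSum_norm_vec (ρ : State H) : HasSum (fun i => ‖ρ.vec i‖ ^ 2) 1 := by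
  have h := Complex.hasSum_re ρ.trace_one
  rw [Complex.one_re] at h
  convert h using 1
  ext i
  rw [← ρ.sqrt_sqrt, ← ρ.inner_sqrt, inner_self_eq_norm_sq_to_K]
  norm_cast

theorem State.summable_norm_vec (ρ : State H) : Summable fun i => ‖ρ.vec i‖ ^ 2 :=
  ρ.hasSum_norm_vec.summable

theorem State.summable_inner_vec (ρ : State H) (B : H →L[ℂ] H) :
    Summable fun i => inner ℂ (ρ.vec i) (B (ρ.vec i)) := by
  refine Summable.of_norm_bounded (ρ.summable_norm_vec.mul_left ‖B‖) fun i => ?_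
  calc _ ≤ ‖ρ.vec i‖ * ‖B (ρ.vec i)‖ := norm_inner_le_norm _ _
    _ ≤ ‖ρ.vec i‖ * (‖B‖ * ‖ρ.vec i‖) := by gcongr; exact B.le_opNorm _
    _ = _ := by ring

/-- This is cyclicity of the trace with `S = √ρ`. It writes `tr (ρ B)` as a sum of vector
functionals whose squared norms add up to one, which replaces the spectral decomposition of `ρ`. -/
theorem State.hasSum_trace (ρ : State H) (B : H →L[ℂ] H) :
    HasSum (fun i => inner ℂ (ρ.vec i) (B (ρ.vec i))) (trace (ρ.op * B)) := by
  have h := hasSum_inner_sq_mul (basis H) ρ.inner_sqrt ρ.summable_norm_vec B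
  simp only [ρ.sqrt_sqrt] at h
  have h' : trace (ρ.op * B) = _ := h.tsum_eq
  rw [h']
  exact (ρ.summable_inner_vec B).hasSum

theorem State.hasSum_inner_op (ρ : State H) (x y : H) :
    HasSum (fun i => inner ℂ x (ρ.vec i) * inner ℂ (ρ.vec i) y) (inner ℂ x (ρ.op y)) := by
  have h := (basis H).hasSum_inner_mul_inner (CFC.sqrt ρ.op x) (CFC.sqrt ρ.op y)
  simp only [ρ.inner_sqrt, ρ.sqrt_sqrt] at h
  refine hasSum_of_eq h fun i => ?_
  rw [show ρ.vec i = CFC.sqrt ρ.op (basis H i) from rfl, ρ.inner_sqrt]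

end Trace

/-! ### Outcome distributions and their characteristic functions -/

section OutcomeMeasure

variable {H : Type*} [NormedAddCommGroup H] [InnerProductSpace ℂ H] [CompleteSpace H]

section Measurable

variable {Ω : Type*} [MeasurableSpace Ω]

theorem POVM.diagMeasure_apply (E : POVM H Ω) (ψ : H) {X : Set Ω} (hX : MeasurableSet X) :
    E.diagMeasure ψ X = ENNReal.ofReal (inner ℂ ψ (E.toFun X ψ)).re :=
  Measure.ofMeasurable_apply X hX

/-- The distribution `X ↦ tr (ρ E(X))` of outcomes as a measure. -/
def State.outcomeMeasure (ρ : State H) (E : POVM H Ω) : Measure Ω :=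
  Measure.sum fun i => E.diagMeasure (ρ.vec i)

theorem State.outcomeMeasure_apply (ρ : State H) (E : POVM H Ω) {X : Set Ω}
    (hX : MeasurableSet X) :
    ρ.outcomeMeasure E X = ENNReal.ofReal (outcomeProb ρ E X).re := by
  have h := Complex.hasSum_re (ρ.hasSum_trace (E.toFun X))
  have hnn (i) : 0 ≤ (inner ℂ (ρ.vec i) (E.toFun X (ρ.vec i))).re :=
    (E.pos X hX).re_inner_nonneg_right _
  rw [State.outcomeMeasure, Measure.sum_apply _ hX, outcomeProb, ← h.tsum_eq,
    ENNReal.ofReal_tsum_of_nonneg hnn h.summable]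
  simp only [E.diagMeasure_apply _ hX]

theorem outcomeProb_nonneg_re (ρ : State H) (E : POVM H Ω) {X : Set Ω}
    (hX : MeasurableSet X) : 0 ≤ (outcomeProb ρ E X).re :=
  (Complex.hasSum_re (ρ.hasSum_trace (E.toFun X))).nonneg fun _ =>
    (E.pos X hX).re_inner_nonneg_right _

theorem outcomeProb_im (ρ : State H) (E : POVM H Ω) {X : Set Ω}
    (hX : MeasurableSet X) : (outcomeProb ρ E X).im = 0 := by
  have h := Complex.hasSum_im (ρ.hasSum_trace (E.toFun X))
  have h0 (i) : (inner ℂ (ρ.vec i) (E.toFun X (ρ.vec i))).im = 0 :=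
    (E.pos X hX).isSymmetric.im_inner_self_apply _
  simp only [h0] at h
  exact h.unique hasSum_zero

theorem outcomeProb_eq_iff (ρ σ : State H) (E : POVM H Ω) :
    (∀ X, MeasurableSet X → outcomeProb ρ E X = outcomeProb σ E X) ↔
      ρ.outcomeMeasure E = σ.outcomeMeasure E := by
  constructor
  · intro h
    ext X hX
    rw [ρ.outcomeMeasure_apply E hX, σ.outcomeMeasure_apply E hX, h X hX]
  · intro h X hX
    have hX' := congrArg (fun μ : Measure Ω => μ X) h
    simp only [ρ.outcomeMeasure_apply E hX, σ.outcomeMeasure_apply E hX] at hX'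
    apply Complex.ext
    · rwa [ENNReal.ofReal_eq_ofReal_iff (outcomeProb_nonneg_re ρ E hX)
        (outcomeProb_nonneg_re σ E hX)] at hX'
    · rw [outcomeProb_im ρ E hX, outcomeProb_im σ E hX]

instance (ρ : State H) (E : POVM H Ω) : IsFiniteMeasure (ρ.outcomeMeasure E) where
  measure_univ_lt_top := by
    rw [ρ.outcomeMeasure_apply E MeasurableSet.univ]
    exact ENNReal.ofReal_lt_top

end Measurable

variable {Ω : Type*} [NormedAddCommGroup Ω] [InnerProductSpace ℝ Ω] [MeasurableSpace Ω]

theorem State.charFun_outcomeMeasure [OpensMeasurableSpace Ω] (ρ : State H) (E : POVM H Ω)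
    {p : Ω} {T : H →L[ℂ] H} (hT : E.HasCharOp p T) :
    charFun (ρ.outcomeMeasure E) p = trace (ρ.op * T) := by
  have hint : Integrable (fun x => Complex.exp (inner ℝ x p * Complex.I))
      (ρ.outcomeMeasure E) := by
    refine Integrable.of_bound (C := 1) ?_ (Filter.Eventually.of_forall fun x => ?_)
    · exact Measurable.aestronglyMeasurable (by fun_prop)
    · rw [Complex.norm_exp_ofReal_mul_I]
  have h := hasSum_integral_measure (μ := fun i => E.diagMeasure (ρ.vec i)) hint
  refine h.unique ?_
  refine hasSum_of_eq (ρ.hasSum_trace T) fun i => ?_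
  exact (hT (ρ.vec i)).symm

/-- Two states have the same outcome statistics iff the traces against the characteristic function
of the observable agree. -/
theorem outcomeProb_eq_iff_trace_eq [BorelSpace Ω] [SecondCountableTopology Ω] [CompleteSpace Ω]
    (ρ σ : State H) (E : POVM H Ω)
    {T : Ω → H →L[ℂ] H} (hT : ∀ p, E.HasCharOp p (T p)) :
    (∀ X, MeasurableSet X → outcomeProb ρ E X = outcomeProb σ E X) ↔
      ∀ p, trace (ρ.op * T p) = trace (σ.op * T p) := by
  rw [outcomeProb_eq_iff]
  constructor
  · intro h p
    rw [← ρ.charFun_outcomeMeasure E (hT p), ← σ.charFun_outcomeMeasure E (hT p), h]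
  · intro h
    refine Measure.ext_of_charFun (funext fun p => ?_)
    rw [ρ.charFun_outcomeMeasure E (hT p), σ.charFun_outcomeMeasure E (hT p), h p]

end OutcomeMeasure

/-! ### Commutation relations and strong continuity of Weyl operators -/

section WeylCalculus

variable {N : ℕ}

theorem continuous_wave (p : EuclideanSpace ℝ (Fin N)) : Continuous (wave p) := by
  unfold wave; fun_prop

theorem coeFn_boost (p : EuclideanSpace ℝ (Fin N)) (f : FieldSpace N) :
    boost p f =ᵐ[volume] fun t => wave p t * f t :=
  (memLp_wave_mul p f).coeFn_toLp

theorem coeFn_shift (q : EuclideanSpace ℝ (Fin N)) (f : FieldSpace N) :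
    shift q f =ᵐ[volume] fun t => f (t - q) :=
  Lp.coeFn_compMeasurePreserving f (measurePreserving_sub_right volume q)

theorem ae_comp_sub {P : EuclideanSpace ℝ (Fin N) → Prop} (h : ∀ᵐ t, P t)
    (q : EuclideanSpace ℝ (Fin N)) : ∀ᵐ t, P (t - q) :=
  (measurePreserving_sub_right volume q).quasiMeasurePreserving.ae h

theorem boost_comm (p p' : EuclideanSpace ℝ (Fin N)) (f : FieldSpace N) :
    boost p (boost p' f) = boost p' (boost p f) := by
  apply Lp.ext
  filter_upwards [coeFn_boost p f, coeFn_boost p' f, coeFn_boost p (boost p' f),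
    coeFn_boost p' (boost p f)] with t h1 h2 h3 h4
  rw [h3, h4, h1, h2]; ring

theorem shift_comm (q q' : EuclideanSpace ℝ (Fin N)) (f : FieldSpace N) :
    shift q (shift q' f) = shift q' (shift q f) := by
  apply Lp.ext
  filter_upwards [ae_comp_sub (coeFn_shift q f) q', ae_comp_sub (coeFn_shift q' f) q,
    coeFn_shift q (shift q' f), coeFn_shift q' (shift q f)] with t h1 h2 h3 h4
  rw [h3, h4, h1, h2, sub_right_comm]

/-- The canonical commutation relation in Weyl form. -/
theorem shift_boost (q p : EuclideanSpace ℝ (Fin N)) (f : FieldSpace N) :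
    shift q (boost p f) = Complex.exp (-(Complex.I * (inner ℝ p q : ℝ))) • boost p (shift q f) := by
  apply Lp.ext
  filter_upwards [ae_comp_sub (coeFn_boost p f) q, coeFn_shift q (boost p f), coeFn_shift q f,
    coeFn_boost p (shift q f), Lp.coeFn_smul (Complex.exp (-(Complex.I * (inner ℝ p q : ℝ))))
      (boost p (shift q f))] with t h1 h2 h3 h4 h5
  rw [h2, h1, h5, Pi.smul_apply, h4, h3, smul_eq_mul, ← mul_assoc, wave, wave, ← Complex.exp_add,
    inner_sub_right]
  push_cast
  ring_nf

theorem inner_eq_integral (f g : FieldSpace N) :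
    inner ℂ f g = ∫ t, starRingEnd ℂ (f t) * g t := by
  rw [L2.inner_def]
  simp only [RCLike.inner_apply, mul_comm]

theorem inner_boost (p : EuclideanSpace ℝ (Fin N)) (f g : FieldSpace N) :
    inner ℂ f (boost p g) = ∫ t, wave p t * (starRingEnd ℂ (f t) * g t) := by
  rw [inner_eq_integral]
  refine integral_congr_ae ?_
  filter_upwards [coeFn_boost p g] with t h
  rw [h]; ring

theorem integrable_conj_mul (f g : FieldSpace N) :
    Integrable fun t => starRingEnd ℂ (f t) * g t := by
  have := L2.integrable_inner (𝕜 := ℂ) f g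
  simpa only [RCLike.inner_apply, mul_comm] using this

theorem inner_boost_boost (p : EuclideanSpace ℝ (Fin N)) (f g : FieldSpace N) :
    inner ℂ (boost p f) (boost p g) = inner ℂ f g := by
  rw [inner_eq_integral, inner_eq_integral]
  refine integral_congr_ae ?_
  filter_upwards [coeFn_boost p f, coeFn_boost p g] with t h1 h2
  rw [h1, h2, map_mul, mul_mul_mul_comm, ← Complex.normSq_eq_conj_mul_self,
    Complex.normSq_eq_norm_sq, norm_wave]
  simp

theorem inner_shift_shift (q : EuclideanSpace ℝ (Fin N)) (f g : FieldSpace N) :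
    inner ℂ (shift q f) (shift q g) = inner ℂ f g :=
  LinearIsometry.inner_map_map _ f g

theorem norm_boost (p : EuclideanSpace ℝ (Fin N)) (f : FieldSpace N) : ‖boost p f‖ = ‖f‖ := by
  rw [@norm_eq_sqrt_re_inner ℂ, @norm_eq_sqrt_re_inner ℂ _ _ _ _ f, inner_boost_boost]

theorem norm_shift (q : EuclideanSpace ℝ (Fin N)) (f : FieldSpace N) : ‖shift q f‖ = ‖f‖ :=
  LinearIsometry.norm_map _ f

theorem continuous_shift (f : FieldSpace N) : Continuous fun q => shift q f := by
  have hcont : Continuous fun q : EuclideanSpace ℝ (Fin N) =>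
      (⟨fun t => t - q, by fun_prop⟩ : C(EuclideanSpace ℝ (Fin N), EuclideanSpace ℝ (Fin N))) :=
    ContinuousMap.continuous_of_continuous_uncurry _ (by
      simp only [Function.uncurry_def, ContinuousMap.coe_mk]; fun_prop)
  exact Continuous.compMeasurePreservingLp continuous_const hcont
    (fun q => measurePreserving_sub_right volume q) ENNReal.ofNat_ne_top

theorem continuous_inner_boost (f g : FieldSpace N) :
    Continuous fun p => inner ℂ f (boost p g) := by
  simp only [inner_boost]
  refine continuous_of_dominated (bound := fun t => ‖starRingEnd ℂ (f t) * g t‖)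
    (fun p => ?_) (fun p => ?_) (integrable_conj_mul f g).norm ?_
  · exact (continuous_wave p).aestronglyMeasurable.mul (integrable_conj_mul f g).1
  · exact Filter.Eventually.of_forall fun t => by rw [norm_mul, norm_wave, one_mul]
  · refine Filter.Eventually.of_forall fun t => ?_
    unfold wave
    fun_prop

theorem continuous_boost (f : FieldSpace N) : Continuous fun p => boost p f := by
  refine continuous_iff_continuousAt.2 fun p₀ => ?_
  rw [ContinuousAt, tendsto_iff_norm_sub_tendsto_zero]
  -- For isometries, weak continuity already gives strong continuity: the squared distance involves
  -- only an inner product.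
  have hsq (p) : ‖boost p f - boost p₀ f‖ =
      √(2 * ‖f‖ ^ 2 - 2 * (inner ℂ (boost p₀ f) (boost p f)).re) := by
    rw [← Real.sqrt_sq (norm_nonneg (boost p f - boost p₀ f)), @norm_sub_sq ℂ, norm_boost,
      norm_boost, ← inner_conj_symm]
    congr 1
    simp only [RCLike.re_eq_complex_re, Complex.conj_re]
    ring
  simp only [hsq]
  have hc : Continuous fun p =>
      √(2 * ‖f‖ ^ 2 - 2 * (inner ℂ (boost p₀ f) (boost p f)).re) := by
    have := continuous_inner_boost (boost p₀ f) f
    fun_prop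
  have h := hc.tendsto p₀
  rwa [← hsq p₀, sub_self, norm_zero] at h

theorem continuous_boost_shift (f : FieldSpace N) :
    Continuous fun x : EuclideanSpace ℝ (Fin N) × EuclideanSpace ℝ (Fin N) =>
      boost x.1 (shift x.2 f) := by
  refine continuous_iff_continuousAt.2 fun x₀ => ?_
  rw [ContinuousAt, tendsto_iff_norm_sub_tendsto_zero]
  have hle (x : EuclideanSpace ℝ (Fin N) × EuclideanSpace ℝ (Fin N)) :
      ‖boost x.1 (shift x.2 f) - boost x₀.1 (shift x₀.2 f)‖ ≤
      ‖shift x.2 f - shift x₀.2 f‖ + ‖boost x.1 (shift x₀.2 f) - boost x₀.1 (shift x₀.2 f)‖ := by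
    rw [← norm_boost x.1 (shift x.2 f - shift x₀.2 f), map_sub]
    exact norm_sub_le_norm_sub_add_norm_sub _ _ _
  have hc : Continuous fun x : EuclideanSpace ℝ (Fin N) × EuclideanSpace ℝ (Fin N) =>
      ‖shift x.2 f - shift x₀.2 f‖ +
        ‖boost x.1 (shift x₀.2 f) - boost x₀.1 (shift x₀.2 f)‖ := by
    have h1 := (continuous_shift f).comp
      (continuous_snd (X := EuclideanSpace ℝ (Fin N)) (Y := EuclideanSpace ℝ (Fin N)))
    have h2 := (continuous_boost (shift x₀.2 f)).comp
      (continuous_fst (X := EuclideanSpace ℝ (Fin N)) (Y := EuclideanSpace ℝ (Fin N)))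
    simp only [Function.comp_def] at h1 h2
    fun_prop
  have h := hc.tendsto x₀
  simp only [sub_self, norm_zero, add_zero] at h
  exact squeeze_zero (fun _ => norm_nonneg _) hle h

theorem PhaseSpace.continuous_q : Continuous (PhaseSpace.q (N := N)) := by
  unfold PhaseSpace.q; fun_prop

theorem PhaseSpace.continuous_p : Continuous (PhaseSpace.p (N := N)) := by
  unfold PhaseSpace.p; fun_prop

theorem weyl_apply (x : PhaseSpace N) (f : FieldSpace N) :
    weyl x f = Complex.exp (-(Complex.I / 2) * (inner ℝ x.q x.p : ℝ)) •
      boost x.p (shift x.q f) := rfl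

theorem norm_weyl_phase (x : PhaseSpace N) :
    ‖Complex.exp (-(Complex.I / 2) * (inner ℝ x.q x.p : ℝ))‖ = 1 := by
  rw [show -(Complex.I / 2) * ((inner ℝ x.q x.p : ℝ) : ℂ) =
    ((-(inner ℝ x.q x.p) / 2 : ℝ) : ℂ) * Complex.I by push_cast; ring,
    Complex.norm_exp_ofReal_mul_I]

theorem norm_weyl (x : PhaseSpace N) (f : FieldSpace N) : ‖weyl x f‖ = ‖f‖ := by
  rw [weyl_apply, norm_smul, norm_boost, norm_shift, norm_weyl_phase, one_mul]

theorem continuous_weyl (f : FieldSpace N) : Continuous fun x => weyl x f := by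
  simp only [weyl_apply]
  have h := (continuous_boost_shift f).comp
    (PhaseSpace.continuous_p.prodMk PhaseSpace.continuous_q)
  have hq := PhaseSpace.continuous_q (N := N)
  have hp := PhaseSpace.continuous_p (N := N)
  have hphase : Continuous fun x : PhaseSpace N =>
      Complex.exp (-(Complex.I / 2) * (inner ℝ x.q x.p : ℝ)) := by fun_prop
  exact hphase.smul h

/-- The characteristic function `x ↦ tr (ρ W(x))` of a state. -/
def State.weylChar (ρ : State (FieldSpace N)) (x : PhaseSpace N) : ℂ := trace (ρ.op * weyl x)

theorem State.continuous_weylChar (ρ : State (FieldSpace N)) : Continuous ρ.weylChar := by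
  have h : ρ.weylChar = fun x => ∑' i, inner ℂ (ρ.vec i) (weyl x (ρ.vec i)) :=
    funext fun x => (ρ.hasSum_trace (weyl x)).tsum_eq.symm
  rw [h]
  refine continuous_tsum (fun i => ?_) ρ.summable_norm_vec fun i x => ?_
  · have := continuous_weyl (ρ.vec i)
    fun_prop
  · refine (norm_inner_le_norm _ _).trans ?_
    rw [norm_weyl, sq]

end WeylCalculus

/-! ### The characteristic function determines the state -/

section WeylInjective

variable {N : ℕ}

theorem countable_of_hilbertBasis {H ι : Type*} [NormedAddCommGroup H] [InnerProductSpace ℂ H]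
    [SecondCountableTopology H] (b : HilbertBasis ι ℂ H) : Countable ι := by
  refine Pairwise.countable_of_isOpen_disjoint (s := fun i => Metric.ball (b i) (1 / 2)) ?_
    (fun _ => Metric.isOpen_ball) (fun i => ⟨b i, Metric.mem_ball_self (by norm_num)⟩)
  intro i j hij
  refine Metric.ball_disjoint_ball ?_
  have h : ‖b i - b j‖ ^ 2 = 2 := by
    rw [@norm_sub_sq ℂ, b.orthonormal.1 i, b.orthonormal.1 j, b.orthonormal.2 hij]
    norm_num
  rw [dist_eq_norm]
  nlinarith [norm_nonneg (b i - b j)]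

instance : Fact ((2 : ENNReal) ≠ ⊤) := ⟨ENNReal.ofNat_ne_top⟩

instance : Countable (BasisIndex (FieldSpace N)) :=
  countable_of_hilbertBasis (basis (FieldSpace N))

theorem trace_smul {H : Type*} [NormedAddCommGroup H] [InnerProductSpace ℂ H] [CompleteSpace H]
    (ρ : State H) (c : ℂ) (B : H →L[ℂ] H) :
    trace (ρ.op * (c • B)) = c * trace (ρ.op * B) := by
  refine (ρ.hasSum_trace (c • B)).unique
    (hasSum_of_eq ((ρ.hasSum_trace B).mul_left c) fun i => ?_)
  rw [smul_apply, inner_smul_right]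

/-- The phase space point with given position and momentum parts. -/
def PhaseSpace.mk (q p : EuclideanSpace ℝ (Fin N)) : PhaseSpace N :=
  WithLp.toLp 2 fun k => ![q k.1, p k.1] k.2

theorem PhaseSpace.mk_q (q p : EuclideanSpace ℝ (Fin N)) : (PhaseSpace.mk q p).q = q := by
  ext j; simp [PhaseSpace.mk, PhaseSpace.q]

theorem PhaseSpace.mk_p (q p : EuclideanSpace ℝ (Fin N)) : (PhaseSpace.mk q p).p = p := by
  ext j; simp [PhaseSpace.mk, PhaseSpace.p]

theorem trace_boost_shift_eq {ρ σ : State (FieldSpace N)} (h : ρ.weylChar = σ.weylChar)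
    (p q : EuclideanSpace ℝ (Fin N)) :
    trace (ρ.op * (boost p * shift q)) = trace (σ.op * (boost p * shift q)) := by
  have h' := congrFun h (PhaseSpace.mk q p)
  simp only [State.weylChar, weyl, trace_smul, PhaseSpace.mk_q, PhaseSpace.mk_p] at h'
  exact mul_left_cancel₀ (Complex.exp_ne_zero _) h'

open FourierTransform in
-- Moving the Fourier transform across the integral shows that multiplication by `𝓕 k` is a
-- superposition of boosts. The factor `-2π` comes from the kernel `exp(-2πi p·t)`.
theorem integral_fourier_mul_conj_mul (k : SchwartzMap (EuclideanSpace ℝ (Fin N)) ℂ)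
    (f g : FieldSpace N) :
    ∫ t, 𝓕 k t * (starRingEnd ℂ (f t) * g t) =
      ∫ p, k p * inner ℂ f (boost (-(2 * Real.pi) • p) g) := by
  have h := VectorFourier.integral_fourierIntegral_smul_eq_flip
    (L := innerₗ (EuclideanSpace ℝ (Fin N))) Real.continuous_fourierChar
    (by simpa using continuous_inner) (k.integrable (μ := volume)) (integrable_conj_mul f g)
  simp only [smul_eq_mul] at h
  refine h.trans (integral_congr_ae (Filter.Eventually.of_forall fun p => ?_))
  simp only [inner_boost, VectorFourier.fourierIntegral]
  congr 1
  refine integral_congr_ae (Filter.Eventually.of_forall fun t => ?_)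
  simp only [wave, Circle.smul_def, Real.fourierChar_apply, smul_eq_mul, LinearMap.flip_apply,
    innerₗ_apply_apply, real_inner_smul_left]
  congr 2
  push_cast
  ring

open FourierTransform in
/-- The functional `B ↦ tr (ρ B)` at the product of a multiplication operator by a Schwartz
function and a translation, in terms of the characteristic function. -/
theorem State.hasSum_integral_schwartz (ρ : State (FieldSpace N))
    (k : SchwartzMap (EuclideanSpace ℝ (Fin N)) ℂ) (q : EuclideanSpace ℝ (Fin N)) :
    HasSum (fun i => ∫ t, 𝓕 k t * (starRingEnd ℂ (ρ.vec i t) * shift q (ρ.vec i) t))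
      (∫ p, k p * trace (ρ.op * (boost (-(2 * Real.pi) • p) * shift q))) := by
  simp only [integral_fourier_mul_conj_mul]
  have hbound (i) (p : EuclideanSpace ℝ (Fin N)) :
      ‖inner ℂ (ρ.vec i) (boost (-(2 * Real.pi) • p) (shift q (ρ.vec i)))‖ ≤ ‖ρ.vec i‖ ^ 2 := by
    refine (norm_inner_le_norm _ _).trans ?_
    rw [norm_boost, norm_shift, sq]
  have hint (i) : Integrable fun p =>
      k p * inner ℂ (ρ.vec i) (boost (-(2 * Real.pi) • p) (shift q (ρ.vec i))) := by
    refine (k.integrable (μ := volume)).mul_bdd (c := ‖ρ.vec i‖ ^ 2) ?_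
      (Filter.Eventually.of_forall fun p => hbound i p)
    have := continuous_inner_boost (ρ.vec i) (shift q (ρ.vec i))
    exact (this.comp (continuous_const_smul (-(2 * Real.pi)))).aestronglyMeasurable
  have hsum : Summable fun i => ∫ p,
      ‖k p * inner ℂ (ρ.vec i) (boost (-(2 * Real.pi) • p) (shift q (ρ.vec i)))‖ := by
    refine Summable.of_nonneg_of_le (fun _ => integral_nonneg fun _ => norm_nonneg _) (fun i => ?_)
      (ρ.summable_norm_vec.mul_left (∫ p, ‖k p‖))
    rw [← integral_mul_const]
    refine integral_mono (hint i).norm ((k.integrable (μ := volume)).norm.mul_const _) fun p => ?_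
    simp only [norm_mul]
    exact mul_le_mul_of_nonneg_left (hbound i p) (norm_nonneg _)
  have h := hasSum_integral_of_summable_integral_norm hint hsum
  rw [show (∫ p, k p * trace (ρ.op * (boost (-(2 * Real.pi) • p) * shift q))) = _ from ?_]
  · exact h
  congr 1
  funext p
  rw [tsum_mul_left]
  congr 1
  exact (ρ.hasSum_trace (boost (-(2 * Real.pi) • p) * shift q)).tsum_eq.symm

/-- Cauchy-Schwarz is applied to `|f|` and `|g|`, since the norm stands inside the integral. -/
theorem integral_norm_conj_mul_le (f g : FieldSpace N) :
    ∫ t, ‖starRingEnd ℂ (f t) * g t‖ ≤ ‖f‖ * ‖g‖ := by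
  let F (h : FieldSpace N) : Lp ℝ 2 (volume : Measure (EuclideanSpace ℝ (Fin N))) :=
    (Lp.memLp h).norm.toLp _
  have hF (h : FieldSpace N) : ‖F h‖ = ‖h‖ := by
    rw [Lp.norm_toLp, eLpNorm_norm, Lp.norm_def]
  have hle := real_inner_le_norm (F f) (F g)
  rw [hF, hF, L2.inner_def] at hle
  refine (integral_congr_ae ?_).trans_le hle
  filter_upwards [(Lp.memLp f).norm.coeFn_toLp, (Lp.memLp g).norm.coeFn_toLp] with t h1 h2
  simp only [F, h1, h2, norm_mul, RCLike.norm_conj]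
  exact mul_comm _ _

open scoped Convolution in
theorem integral_norm_convolution_le {a b : EuclideanSpace ℝ (Fin N) → ℂ} (ha : Integrable a)
    (hb : Integrable b) :
    ∫ q, ‖(a ⋆[ContinuousLinearMap.mul ℂ ℂ, volume] b) q‖ ≤ (∫ t, ‖a t‖) * ∫ t, ‖b t‖ := by
  have h := integral_convolution (ContinuousLinearMap.mul ℝ ℝ) ha.norm hb.norm
  rw [ContinuousLinearMap.mul_apply'] at h
  rw [← h]
  refine integral_mono (ha.integrable_convolution _ hb).norm
    (ha.norm.integrable_convolution _ hb.norm) fun q => ?_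
  refine (norm_integral_le_integral_norm _).trans_eq ?_
  refine integral_congr_ae (Filter.Eventually.of_forall fun t => ?_)
  simp only [ContinuousLinearMap.mul_apply', norm_mul]

open scoped Convolution in
/-- Integrating the translation parameter against `ψ(t) conj(φ(t - q))` produces the matrix element
of the state. -/
theorem State.inner_op_eq_integral (ρ : State (FieldSpace N)) (φ ψ : FieldSpace N) :
    inner ℂ φ (ρ.op ψ) = ∫ q, ∑' i, ∫ t, ψ t * starRingEnd ℂ (φ (t - q)) *
      (starRingEnd ℂ (ρ.vec i t) * ρ.vec i (t - q)) := by
  -- The inner integral is a convolution in `q`, with `b` reflected because `φ` and `ρ.vec i` are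
  -- evaluated at `t - q`. Its total integral is the product `⟨φ, vᵢ⟩ ⟨vᵢ, ψ⟩` with `vᵢ = ρ.vec i`,
  -- a term of the expansion of `⟨φ, ρ ψ⟩`.
  let a (i) (t : EuclideanSpace ℝ (Fin N)) : ℂ := starRingEnd ℂ (ρ.vec i t) * ψ t
  let b (i) (t : EuclideanSpace ℝ (Fin N)) : ℂ := starRingEnd ℂ (φ (-t)) * ρ.vec i (-t)
  have ha (i) : Integrable (a i) := integrable_conj_mul _ _
  have hb (i) : Integrable (b i) := (integrable_conj_mul φ (ρ.vec i)).comp_neg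
  have hconv (i) : (fun q => ∫ t, ψ t * starRingEnd ℂ (φ (t - q)) *
      (starRingEnd ℂ (ρ.vec i t) * ρ.vec i (t - q))) =
      (a i) ⋆[ContinuousLinearMap.mul ℂ ℂ, volume] (b i) := by
    funext q
    refine integral_congr_ae (Filter.Eventually.of_forall fun t => ?_)
    simp only [a, b, ContinuousLinearMap.mul_apply', neg_sub]
    ring
  have hnorm (i) : ∫ q, ‖((a i) ⋆[ContinuousLinearMap.mul ℂ ℂ, volume] (b i)) q‖ ≤
      (‖φ‖ * ‖ψ‖) * ‖ρ.vec i‖ ^ 2 := by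
    refine (integral_norm_convolution_le (ha i) (hb i)).trans ?_
    have h1 : ∫ t, ‖a i t‖ ≤ ‖ρ.vec i‖ * ‖ψ‖ := integral_norm_conj_mul_le _ _
    have h2 : ∫ t, ‖b i t‖ ≤ ‖φ‖ * ‖ρ.vec i‖ :=
      (integral_neg_eq_self (fun t => ‖starRingEnd ℂ (φ t) * ρ.vec i t‖) volume).trans_le
        (integral_norm_conj_mul_le _ _)
    calc _ ≤ (‖ρ.vec i‖ * ‖ψ‖) * (‖φ‖ * ‖ρ.vec i‖) := by
          gcongr
      _ = _ := by ring
  have h := hasSum_integral_of_summable_integral_norm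
    (fun i => (ha i).integrable_convolution (ContinuousLinearMap.mul ℂ ℂ) (hb i))
    (Summable.of_nonneg_of_le (fun _ => integral_nonneg fun _ => norm_nonneg _) hnorm
      (ρ.summable_norm_vec.mul_left _))
  simp only [← hconv] at h
  refine (ρ.hasSum_inner_op φ ψ).unique (hasSum_of_eq h fun i => ?_)
  rw [hconv, integral_convolution _ (ha i) (hb i), ContinuousLinearMap.mul_apply', mul_comm,
    inner_eq_integral, inner_eq_integral]
  congr 1
  exact (integral_neg_eq_self (fun t => starRingEnd ℂ (φ t) * ρ.vec i t) volume).symm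

theorem State.ext_of_inner {ρ σ : State (FieldSpace N)} {D : Set (FieldSpace N)} (hD : Dense D)
    (h : ∀ φ ∈ D, ∀ ψ ∈ D, inner ℂ φ (ρ.op ψ) = inner ℂ φ (σ.op ψ)) : ρ = σ := by
  have hop : ρ.op = σ.op := by
    refine ContinuousLinearMap.ext_on (s := D) (hD.mono Submodule.subset_span) fun ψ hψ => ?_
    have : Set.EqOn (fun φ => inner ℂ φ (ρ.op ψ)) (fun φ => inner ℂ φ (σ.op ψ)) D :=
      fun φ hφ => h φ hφ ψ hψ
    have h' := Continuous.ext_on hD (by fun_prop) (by fun_prop) this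
    exact ext_inner_left ℂ fun φ => congrFun h' φ
  cases ρ; cases σ; congr

open FourierTransform in
/-- A state is determined by its characteristic function. -/
theorem State.weylChar_injective {ρ σ : State (FieldSpace N)} (h : ρ.weylChar = σ.weylChar) :
    ρ = σ := by
  refine State.ext_of_inner (Lp.dense_hasCompactSupport_contDiff ENNReal.ofNat_ne_top) ?_
  rintro φ ⟨φ', hφ, hφc, hφs⟩ ψ ⟨ψ', hψ, hψc, hψs⟩
  rw [ρ.inner_op_eq_integral, σ.inner_op_eq_integral]
  congr 1
  funext q
  have hgc : HasCompactSupport fun t => ψ' t * starRingEnd ℂ (φ' (t - q)) := hψc.mul_right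
  have hgs : ContDiff ℝ (⊤ : ℕ∞) fun t => ψ' t * starRingEnd ℂ (φ' (t - q)) :=
    hψs.mul (Complex.conjCLE.contDiff.comp (hφs.comp (contDiff_id.sub contDiff_const)))
  -- For test functions the weight `ψ(t) conj(φ(t - q))` is Schwartz, hence the Fourier transform of
  -- its inverse transform. Each `q`-slice thus depends on `τ` only through traces against boosts
  -- times shifts.
  have key (τ : State (FieldSpace N)) : HasSum (fun i => ∫ t, ψ t * starRingEnd ℂ (φ (t - q)) *
      (starRingEnd ℂ (τ.vec i t) * τ.vec i (t - q)))
      (∫ p, 𝓕⁻ (hgc.toSchwartzMap hgs) p *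
        trace (τ.op * (boost (-(2 * Real.pi) • p) * shift q))) := by
    refine hasSum_of_eq (τ.hasSum_integral_schwartz (𝓕⁻ (hgc.toSchwartzMap hgs)) q) fun i => ?_
    refine integral_congr_ae ?_
    filter_upwards [hψ, ae_comp_sub hφ q, coeFn_shift q (τ.vec i)] with t h1 h2 h3
    rw [FourierTransform.fourier_fourierInv_eq, h1, h2, h3]
    rfl
  rw [(key ρ).tsum_eq, (key σ).tsum_eq]
  simp only [trace_boost_shift_eq h]

end WeylInjective

/-! ### Continuous mixtures of pure states -/

section Mixture

variable {H : Type*} [NormedAddCommGroup H] [InnerProductSpace ℂ H] [CompleteSpace H]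
variable {Z : Type*} [TopologicalSpace Z] [SecondCountableTopology Z] [MeasurableSpace Z]
  [OpensMeasurableSpace Z]

theorem integrable_rankOne (μ : Measure Z) [IsFiniteMeasure μ] {ξ : Z → H} (hξ : Continuous ξ)
    (hnorm : ∀ z, ‖ξ z‖ = 1) :
    Integrable (fun z => InnerProductSpace.rankOne ℂ (ξ z) (ξ z)) μ := by
  have hc : Continuous fun z => InnerProductSpace.rankOne ℂ (ξ z) (ξ z) :=
    (ContinuousLinearMap.smulRightL ℂ H H).continuous₂.comp
      (((innerSL ℂ).continuous.comp hξ).prodMk hξ)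
  refine Integrable.of_bound (C := 1) hc.aestronglyMeasurable
    (Filter.Eventually.of_forall fun z => ?_)
  rw [InnerProductSpace.norm_rankOne, hnorm, one_mul]

/-- The mixture `∫ |ξ z⟩⟨ξ z| μ(dz)` of rank one operators. -/
def mixOp (μ : Measure Z) (ξ : Z → H) : H →L[ℂ] H :=
  ∫ z, InnerProductSpace.rankOne ℂ (ξ z) (ξ z) ∂μ

theorem inner_mixOp (μ : Measure Z) [IsFiniteMeasure μ] {ξ : Z → H} (hξ : Continuous ξ)
    (hnorm : ∀ z, ‖ξ z‖ = 1) (x y : H) :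
    inner ℂ x (mixOp μ ξ y) = ∫ z, inner ℂ x (ξ z) * inner ℂ (ξ z) y ∂μ := by
  have hint := integrable_rankOne μ hξ hnorm
  rw [mixOp, ContinuousLinearMap.integral_apply hint,
    ← integral_inner (hint.apply_continuousLinearMap y)]
  simp only [InnerProductSpace.rankOne_apply, inner_smul_right, mul_comm]

theorem hasSum_mixOp (μ : Measure Z) [IsFiniteMeasure μ] {ξ : Z → H} (hξ : Continuous ξ)
    (hnorm : ∀ z, ‖ξ z‖ = 1) {ι : Type*} [Countable ι] (b : HilbertBasis ι ℂ H)
    (B : H →L[ℂ] H) :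
    HasSum (fun i => inner ℂ (b i) (mixOp μ ξ (B (b i)))) (∫ z, inner ℂ (ξ z) (B (ξ z)) ∂μ) := by
  obtain ⟨C, hC⟩ : ∃ C : H →L[ℂ] H, ∀ x y, inner ℂ (C x) y = inner ℂ x (B y) :=
    ⟨ContinuousLinearMap.adjoint B, fun x y => ContinuousLinearMap.adjoint_inner_left B y x⟩
  simp only [inner_mixOp μ hξ hnorm, ← hC]
  have htsum (z : Z) := (hasSum_norm_inner_sq b (ξ z)).add (hasSum_norm_inner_sq b (C (ξ z)))
  -- The bound `x y ≤ x² + y²` gives a dominating series whose sum is `‖ξ z‖² + ‖C (ξ z)‖²` by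
  -- Parseval, at most `1 + ‖C‖²`.
  refine hasSum_integral_of_dominated_convergence
    (fun i z => ‖inner ℂ (b i) (ξ z)‖ ^ 2 + ‖inner ℂ (b i) (C (ξ z))‖ ^ 2)
    (fun i => ?_) (fun i => Filter.Eventually.of_forall fun z => ?_)
    (Filter.Eventually.of_forall fun z => (htsum z).summable) ?_
    (Filter.Eventually.of_forall fun z => ?_)
  · exact Continuous.aestronglyMeasurable (by fun_prop)
  · rw [norm_mul, norm_inner_symm (C (ξ z))]
    generalize ‖inner ℂ (b i) (ξ z)‖ = x
    generalize ‖inner ℂ (b i) (C (ξ z))‖ = y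
    nlinarith [sq_nonneg (x - y), sq_nonneg (x + y)]
  · simp only [(htsum _).tsum_eq]
    refine Integrable.of_bound (C := 1 + ‖C‖ ^ 2)
      (Continuous.aestronglyMeasurable (by fun_prop)) (Filter.Eventually.of_forall fun z => ?_)
    have hle : ‖C (ξ z)‖ ≤ ‖C‖ := by simpa [hnorm z] using C.le_opNorm (ξ z)
    rw [Real.norm_of_nonneg (by positivity), hnorm z, one_pow]
    gcongr
  · refine hasSum_of_eq (b.hasSum_inner_mul_inner (C (ξ z)) (ξ z)) fun i => mul_comm _ _

theorem isPositive_mixOp (μ : Measure Z) [IsFiniteMeasure μ] {ξ : Z → H} (hξ : Continuous ξ)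
    (hnorm : ∀ z, ‖ξ z‖ = 1) : (mixOp μ ξ).IsPositive := by
  rw [ContinuousLinearMap.isPositive_iff_complex]
  intro x
  have h : inner ℂ x (mixOp μ ξ x) = ((∫ z, ‖inner ℂ (ξ z) x‖ ^ 2 ∂μ : ℝ) : ℂ) := by
    rw [inner_mixOp μ hξ hnorm, ← integral_complex_ofReal]
    congr 1
    funext z
    rw [← inner_conj_symm x, ← Complex.normSq_eq_conj_mul_self, Complex.normSq_eq_norm_sq]
  rw [← inner_conj_symm, h, Complex.conj_ofReal]
  exact ⟨rfl, integral_nonneg fun z => sq_nonneg _⟩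

/-- A mixture of pure states. -/
def mixState [Countable (BasisIndex H)] (μ : Measure Z) [IsProbabilityMeasure μ] {ξ : Z → H}
    (hξ : Continuous ξ) (hnorm : ∀ z, ‖ξ z‖ = 1) : State H where
  op := mixOp μ ξ
  pos := isPositive_mixOp μ hξ hnorm
  trace_one := by
    have h := hasSum_mixOp μ hξ hnorm (basis H) 1
    simpa [inner_self_eq_norm_sq_to_K, hnorm] using h

theorem trace_mixState [Countable (BasisIndex H)] (μ : Measure Z) [IsProbabilityMeasure μ]
    {ξ : Z → H} (hξ : Continuous ξ) (hnorm : ∀ z, ‖ξ z‖ = 1) (B : H →L[ℂ] H) :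
    trace ((mixState μ hξ hnorm).op * B) = ∫ z, inner ℂ (ξ z) (B (ξ z)) ∂μ :=
  (hasSum_mixOp μ hξ hnorm (basis H) B).tsum_eq

end Mixture

/-! ### Displaced Gaussian vectors -/

section Coherent

variable {N : ℕ}

/-- The vector `φ` displaced in phase space so that its characteristic function is modulated by the
plane wave with frequency `z`. -/
def displaced (φ : FieldSpace N) (z : PhaseSpace N) : FieldSpace N :=
  boost ((2 * Real.pi) • z.q) (shift (-(2 * Real.pi) • z.p) φ)

theorem norm_displaced (φ : FieldSpace N) (z : PhaseSpace N) : ‖displaced φ z‖ = ‖φ‖ := by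
  rw [displaced, norm_boost, norm_shift]

theorem continuous_displaced (φ : FieldSpace N) : Continuous (displaced φ) := by
  have hq := PhaseSpace.continuous_q (N := N)
  have hp := PhaseSpace.continuous_p (N := N)
  have h : Continuous fun z : PhaseSpace N => ((2 * Real.pi) • z.q, -(2 * Real.pi) • z.p) := by
    fun_prop
  have h' := (continuous_boost_shift φ).comp h
  simp only [Function.comp_def] at h'
  unfold displaced
  exact h'

theorem PhaseSpace.inner_eq (x y : PhaseSpace N) :
    inner ℝ x y = inner ℝ x.q y.q + inner ℝ x.p y.p := by
  simp only [PiLp.inner_apply, Fintype.sum_prod_type, Fin.sum_univ_two, PhaseSpace.q, PhaseSpace.p,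
    Finset.sum_add_distrib]

/-- The Weyl operator commutes with the displacement up to the phase collected from `shift_boost`,
and the displacement preserves inner products. The scaling by `2π` in `displaced` makes this phase
the Fourier kernel. -/
theorem inner_displaced_weyl (φ : FieldSpace N) (z y : PhaseSpace N) :
    inner ℂ (displaced φ z) (weyl y (displaced φ z)) =
      Complex.exp (-(2 * Real.pi * Complex.I * (inner ℝ z y : ℝ))) * inner ℂ φ (weyl y φ) := by
  have h : boost y.p (shift y.q (displaced φ z)) =
      Complex.exp (-(2 * Real.pi * Complex.I * (inner ℝ z y : ℝ))) •
        displaced (boost y.p (shift y.q φ)) z := by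
    simp only [displaced, shift_boost, map_smul, smul_smul, ← Complex.exp_add]
    rw [shift_comm y.q, boost_comm y.p]
    congr 2
    rw [PhaseSpace.inner_eq, real_inner_smul_left, real_inner_smul_right, real_inner_comm y.p]
    push_cast
    ring
  rw [weyl_apply, weyl_apply, inner_smul_right, inner_smul_right, h, inner_smul_right, displaced,
    displaced, inner_boost_boost, inner_shift_shift]
  ring

theorem memLp_gaussian :
    MemLp (fun t : EuclideanSpace ℝ (Fin N) => Complex.exp (-(1 / 2 : ℂ) * ‖t‖ ^ 2)) 2 volume := by
  have hc : Continuous fun t : EuclideanSpace ℝ (Fin N) =>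
      Complex.exp (-(1 / 2 : ℂ) * ‖t‖ ^ 2) := by fun_prop
  rw [memLp_two_iff_integrable_sq_norm hc.aestronglyMeasurable]
  have h := (GaussianFourier.integrable_cexp_neg_mul_sq_norm_add (b := 1) (by simp) 0
    (0 : EuclideanSpace ℝ (Fin N))).norm
  refine h.congr (Filter.Eventually.of_forall fun t => ?_)
  simp only [← Complex.norm_pow, ← Complex.exp_nat_mul]
  congr 2
  push_cast
  ring_nf

/-- The Gaussian `t ↦ exp(-|t|² / 2)`. -/
def gaussian (N : ℕ) : FieldSpace N := (memLp_gaussian (N := N)).toLp _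

/-- Centring the product of the two Gaussians at `q / 2` leaves an explicit Gaussian integral times
an exponential. Vanishing nowhere matters: a zero could hide a difference between the two measures.
-/
theorem inner_gaussian_boost_shift (p q : EuclideanSpace ℝ (Fin N)) :
    inner ℂ (gaussian N) (boost p (shift q (gaussian N))) ≠ 0 := by
  have hg := (memLp_gaussian (N := N)).coeFn_toLp
  have h : inner ℂ (gaussian N) (boost p (shift q (gaussian N))) =
      Complex.exp (-(‖q‖ ^ 2 / 4 : ℂ) + Complex.I * (inner ℝ p q : ℝ) / 2) *
      ∫ t : EuclideanSpace ℝ (Fin N),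
        Complex.exp (-(1 : ℂ) * ‖t‖ ^ 2 + Complex.I * (inner ℝ p t : ℝ)) := by
    rw [inner_boost, ← integral_const_mul, ← integral_sub_right_eq_self
      (fun t : EuclideanSpace ℝ (Fin N) =>
        Complex.exp (-(‖q‖ ^ 2 / 4 : ℂ) + Complex.I * (inner ℝ p q : ℝ) / 2) *
        Complex.exp (-(1 : ℂ) * ‖t‖ ^ 2 + Complex.I * (inner ℝ p t : ℝ))) ((1 / 2 : ℝ) • q)]
    refine integral_congr_ae ?_
    filter_upwards [hg, ae_comp_sub hg q, coeFn_shift q (gaussian N)] with t h1 h2 h3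
    rw [h3, gaussian, h1, h2, ← Complex.exp_conj, wave, ← Complex.exp_add, ← Complex.exp_add,
      ← Complex.exp_add]
    congr 1
    have e1 : ((‖t - q‖ ^ 2 : ℝ) : ℂ) = ((‖t‖ ^ 2 - 2 * inner ℝ t q + ‖q‖ ^ 2 : ℝ) : ℂ) := by
      rw [norm_sub_sq_real]
    have e2 : ((‖t - (1 / 2 : ℝ) • q‖ ^ 2 : ℝ) : ℂ) =
        ((‖t‖ ^ 2 - inner ℝ t q + ‖q‖ ^ 2 / 4 : ℝ) : ℂ) := by
      rw [norm_sub_sq_real, real_inner_smul_right, norm_smul]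
      norm_num
      ring
    push_cast at e1 e2
    simp only [map_mul, map_neg, map_div₀, map_one, map_pow, Complex.conj_ofReal, map_ofNat, e1, e2,
      inner_sub_right, real_inner_smul_right]
    push_cast
    ring
  rw [h, GaussianFourier.integral_cexp_neg_mul_sq_norm_add (by simp)]
  refine mul_ne_zero (Complex.exp_ne_zero _) (mul_ne_zero ?_ (Complex.exp_ne_zero _))
  rw [div_one, Ne, Complex.cpow_eq_zero_iff]
  simp [Real.pi_ne_zero]

theorem exists_inner_weyl_ne_zero (N : ℕ) :
    ∃ φ : FieldSpace N, ‖φ‖ = 1 ∧ ∀ y, inner ℂ φ (weyl y φ) ≠ 0 := by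
  have hW (y) : inner ℂ (gaussian N) (weyl y (gaussian N)) ≠ 0 := by
    rw [weyl_apply, inner_smul_right]
    exact mul_ne_zero (Complex.exp_ne_zero _) (inner_gaussian_boost_shift _ _)
  have h0 : gaussian N ≠ 0 := fun h => hW 0 (by rw [h, inner_zero_left])
  refine ⟨((‖gaussian N‖⁻¹ : ℝ) : ℂ) • gaussian N, ?_, fun y => ?_⟩
  · rw [norm_smul, Complex.norm_real, norm_inv, norm_norm, inv_mul_cancel₀ (norm_ne_zero_iff.2 h0)]
  · rw [map_smul, inner_smul_left, inner_smul_right, Complex.conj_ofReal]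
    have : ((‖gaussian N‖⁻¹ : ℝ) : ℂ) ≠ 0 := by
      rw [Ne, Complex.ofReal_eq_zero]; exact inv_ne_zero (norm_ne_zero_iff.2 h0)
    exact mul_ne_zero this (mul_ne_zero this (hW y))

end Coherent

/-! ### Probability measures with prescribed Fourier difference -/

section SignedDensity

theorem isProbabilityMeasure_withDensity_ofReal {V : Type*} [MeasurableSpace V] {μ : Measure V}
    {u : V → ℝ} (hu : Integrable u μ) (h0 : ∀ z, 0 ≤ u z) (h1 : ∫ z, u z ∂μ = 1) :
    IsProbabilityMeasure (μ.withDensity fun z => ENNReal.ofReal (u z)) where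
  measure_univ := by
    rw [withDensity_apply _ MeasurableSet.univ, Measure.restrict_univ,
      ← ofReal_integral_eq_lintegral_ofReal hu (Filter.Eventually.of_forall h0), h1,
      ENNReal.ofReal_one]

theorem integral_withDensity_ofReal {V : Type*} [MeasurableSpace V] {μ : Measure V}
    {u : V → ℝ} (hu : Measurable u) (h0 : ∀ z, 0 ≤ u z) (F : V → ℂ) :
    ∫ z, F z ∂(μ.withDensity fun z => ENNReal.ofReal (u z)) = ∫ z, (u z : ℂ) * F z ∂μ := by
  rw [integral_withDensity_eq_integral_toReal_smul (by fun_prop)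
    (Filter.Eventually.of_forall fun _ => ENNReal.ofReal_lt_top)]
  simp only [ENNReal.toReal_ofReal (h0 _), Complex.real_smul]

variable {V : Type*} [NormedAddCommGroup V] [InnerProductSpace ℝ V] [FiniteDimensional ℝ V]
  [MeasurableSpace V] [BorelSpace V]

open FourierTransform in
-- Conjugating a function replaces its Fourier transform `b(w)` by `conj(b(-w))`, so taking the real
-- part averages the two.
theorem integral_exp_mul_re_fourierInv (b : SchwartzMap V ℂ) (w : V) :
    ∫ z, (((𝓕⁻ b z).re : ℝ) : ℂ) * Complex.exp (-(2 * Real.pi * Complex.I * (inner ℝ z w : ℝ))) =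
      (b w + starRingEnd ℂ (b (-w))) / 2 := by
  have hF (w : V) : ∫ z, 𝓕⁻ b z * Complex.exp (-(2 * Real.pi * Complex.I * (inner ℝ z w : ℝ))) =
      b w := by
    have h : 𝓕 (𝓕⁻ b) w = b w := by rw [FourierTransform.fourier_fourierInv_eq]
    rw [← h, SchwartzMap.fourier_coe, Real.fourier_eq']
    refine integral_congr_ae (Filter.Eventually.of_forall fun z => ?_)
    simp only [smul_eq_mul]
    rw [mul_comm]
    congr 2
    push_cast
    ring
  have hint (w : V) : Integrable fun z =>
      𝓕⁻ b z * Complex.exp (-(2 * Real.pi * Complex.I * (inner ℝ z w : ℝ))) := by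
    refine ((𝓕⁻ b).integrable (μ := volume)).mul_bdd (c := 1)
      (Continuous.aestronglyMeasurable (by fun_prop)) (Filter.Eventually.of_forall fun z => ?_)
    rw [show -(2 * Real.pi * Complex.I * ((inner ℝ z w : ℝ) : ℂ)) =
      ((-(2 * Real.pi * inner ℝ z w) : ℝ) : ℂ) * Complex.I by push_cast; ring,
      Complex.norm_exp_ofReal_mul_I]
  have hconj : starRingEnd ℂ (b (-w)) = ∫ z, starRingEnd ℂ (𝓕⁻ b z *
      Complex.exp (-(2 * Real.pi * Complex.I * (inner ℝ z (-w) : ℝ)))) := by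
    rw [integral_conj, hF]
  have hint' : Integrable fun z => starRingEnd ℂ (𝓕⁻ b z *
      Complex.exp (-(2 * Real.pi * Complex.I * (inner ℝ z (-w) : ℝ)))) :=
    Complex.conjCLE.toContinuousLinearMap.integrable_comp (hint (-w))
  rw [hconj, ← hF w, ← integral_add (hint w) hint', ← integral_div]
  refine integral_congr_ae (Filter.Eventually.of_forall fun z => ?_)
  simp only [map_mul, ← Complex.exp_conj, Complex.re_eq_add_conj, map_neg, Complex.conj_ofReal,
    Complex.conj_I, map_ofNat, inner_neg_right, Complex.ofReal_neg]
  ring_nf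

open FourierTransform in
/-- There are two probability measures whose Fourier transforms differ by a nonzero multiple of the
hermitian part of a given Schwartz function vanishing at the origin. -/
theorem exists_probabilityMeasure_pair (b : SchwartzMap V ℂ) (hb0 : b 0 = 0) {w₀ : V}
    (hw₀ : b w₀ + starRingEnd ℂ (b (-w₀)) ≠ 0) :
    ∃ μ ν : Measure V, IsProbabilityMeasure μ ∧ IsProbabilityMeasure ν ∧ ∃ c : ℂ, c ≠ 0 ∧ ∀ w,
      ∫ z, Complex.exp (-(2 * Real.pi * Complex.I * (inner ℝ z w : ℝ))) ∂μ -
      ∫ z, Complex.exp (-(2 * Real.pi * Complex.I * (inner ℝ z w : ℝ))) ∂ν =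
        c * (b w + starRingEnd ℂ (b (-w))) := by
  set h : V → ℝ := fun z => (𝓕⁻ b z).re with hdef
  have hcont : Continuous h := by fun_prop
  have hint : Integrable h := ((𝓕⁻ b).integrable (μ := volume)).re
  -- Because `b 0 = 0`, the positive and negative parts of `h` have the same mass `m`, so one
  -- constant normalizes both.
  have hzero : ∫ z, h z = 0 := by
    have := integral_exp_mul_re_fourierInv b 0
    simp only [inner_zero_right, Complex.ofReal_zero, mul_zero, neg_zero, Complex.exp_zero,
      mul_one, hb0, map_zero, add_zero, zero_div] at this
    rwa [integral_complex_ofReal, Complex.ofReal_eq_zero] at this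
  have hpm (z) : h z = max (h z) 0 - max (-h z) 0 := by
    rcases le_total 0 (h z) with hz | hz
    · rw [max_eq_left hz, max_eq_right (by linarith)]; ring
    · rw [max_eq_right hz, max_eq_left (by linarith)]; ring
  have hm : ∫ z, max (-h z) 0 = ∫ z, max (h z) 0 := by
    have : ∫ z, h z = (∫ z, max (h z) 0) - ∫ z, max (-h z) 0 := by
      rw [← integral_sub hint.pos_part hint.neg_part]
      exact integral_congr_ae (Filter.Eventually.of_forall hpm)
    linarith
  set m : ℝ := ∫ z, max (h z) 0 with hmdef
  have hm0 : 0 ≤ m := integral_nonneg fun z => le_max_right _ _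
  -- Zero mass would make `h` vanish almost everywhere, and with it the hermitian part of `b` at
  -- `w₀`.
  have hmne : m ≠ 0 := by
    intro hm'
    rw [hm'] at hm
    have hP := (integral_eq_zero_iff_of_nonneg (fun z => le_max_right (h z) 0) hint.pos_part).1
      (hmdef.symm.trans hm')
    have hM := (integral_eq_zero_iff_of_nonneg (fun z => le_max_right (-h z) 0) hint.neg_part).1 hm
    have hae : ∀ᵐ z, h z = 0 := by
      filter_upwards [hP, hM] with z h1 h2
      rw [hpm z, h1, h2, sub_self]
    apply hw₀
    have := integral_exp_mul_re_fourierInv b w₀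
    rw [integral_eq_zero_of_ae] at this
    · linear_combination -2 * this
    · filter_upwards [hae] with z hz
      simp only [hdef] at hz
      simp [hz]
  have hP : IsProbabilityMeasure (volume.withDensity fun z => ENNReal.ofReal (max (h z) 0 / m)) :=
    isProbabilityMeasure_withDensity_ofReal (hint.pos_part.div_const m)
      (fun z => div_nonneg (le_max_right _ _) hm0) (by rw [integral_div, ← hmdef, div_self hmne])
  have hM : IsProbabilityMeasure (volume.withDensity fun z => ENNReal.ofReal (max (-h z) 0 / m)) :=
    isProbabilityMeasure_withDensity_ofReal (hint.neg_part.div_const m)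
      (fun z => div_nonneg (le_max_right _ _) hm0) (by rw [integral_div, hm, div_self hmne])
  -- In the constant, `1 / m` is the normalization and `1 / 2` belongs to the hermitian part.
  refine ⟨_, _, hP, hM, 1 / (2 * m), by simpa using hmne, fun w => ?_⟩
  have hexp (z : V) : ‖Complex.exp (-(2 * Real.pi * Complex.I * (inner ℝ z w : ℝ)))‖ ≤ 1 := by
    rw [show -(2 * Real.pi * Complex.I * ((inner ℝ z w : ℝ) : ℂ)) =
      ((-(2 * Real.pi * inner ℝ z w) : ℝ) : ℂ) * Complex.I by push_cast; ring,
      Complex.norm_exp_ofReal_mul_I]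
  have hexpc : Continuous fun z : V =>
    Complex.exp (-(2 * Real.pi * Complex.I * (inner ℝ z w : ℝ))) := by fun_prop
  have hI {u : V → ℝ} (hu : Integrable u) : Integrable fun z =>
      (u z : ℂ) * Complex.exp (-(2 * Real.pi * Complex.I * (inner ℝ z w : ℝ))) :=
    hu.ofReal.mul_bdd (c := 1) hexpc.aestronglyMeasurable (Filter.Eventually.of_forall hexp)
  rw [integral_withDensity_ofReal (by fun_prop) (fun z => div_nonneg (le_max_right _ _) hm0),
    integral_withDensity_ofReal (by fun_prop) (fun z => div_nonneg (le_max_right _ _) hm0),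
    ← integral_sub (hI (hint.pos_part.div_const m)) (hI (hint.neg_part.div_const m))]
  have hfin := integral_exp_mul_re_fourierInv b w
  rw [show 1 / (2 * (m : ℂ)) * (b w + starRingEnd ℂ (b (-w))) =
    (1 / (m : ℂ)) * ((b w + starRingEnd ℂ (b (-w))) / 2) by field_simp, ← hfin,
    ← integral_const_mul]
  refine integral_congr_ae (Filter.Eventually.of_forall fun z => ?_)
  have hz : ((h z : ℝ) : ℂ) = ((max (h z) 0 - max (-h z) 0 : ℝ) : ℂ) := by rw [← hpm z]
  change _ = 1 / (m : ℂ) * (((h z : ℝ) : ℂ) * _)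
  rw [hz]
  push_cast
  ring

end SignedDensity

/-! ### Informational completeness and density of directions -/

section Completeness

variable {N : ℕ}

/-- Mixing the displaced vectors with `μ` and `ν` gives characteristic functions that differ by the
hermitian part of `b` times a nowhere zero function. -/
theorem exists_state_pair (b : SchwartzMap (PhaseSpace N) ℂ) (hb0 : b 0 = 0) {w₀ : PhaseSpace N}
    (hw₀ : b w₀ + starRingEnd ℂ (b (-w₀)) ≠ 0) :
    ∃ ρ σ : State (FieldSpace N), ρ ≠ σ ∧
      ∀ w, b w + starRingEnd ℂ (b (-w)) = 0 → ρ.weylChar w = σ.weylChar w := by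
  obtain ⟨μ, ν, hμ, hν, c, hc, hdiff⟩ := exists_probabilityMeasure_pair b hb0 hw₀
  obtain ⟨φ, hφ, hφW⟩ := exists_inner_weyl_ne_zero N
  have hnorm (z) : ‖displaced φ z‖ = 1 := by rw [norm_displaced, hφ]
  have hchar (τ : Measure (PhaseSpace N)) [IsProbabilityMeasure τ] (w : PhaseSpace N) :
      (mixState τ (continuous_displaced φ) hnorm).weylChar w =
        (∫ z, Complex.exp (-(2 * Real.pi * Complex.I * (inner ℝ z w : ℝ))) ∂τ) *
          inner ℂ φ (weyl w φ) := by
    rw [State.weylChar, trace_mixState, ← integral_mul_const]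
    simp only [inner_displaced_weyl]
  refine ⟨mixState μ (continuous_displaced φ) hnorm, mixState ν (continuous_displaced φ) hnorm,
    fun heq => ?_, fun w hw => ?_⟩
  · have h := hdiff w₀
    have h' : (mixState μ (continuous_displaced φ) hnorm).weylChar w₀ =
      (mixState ν (continuous_displaced φ) hnorm).weylChar w₀ := by rw [heq]
    rw [hchar, hchar] at h'
    rw [mul_right_cancel₀ (hφW w₀) h', sub_self] at h
    exact mul_ne_zero hc hw₀ h.symm
  · have h := hdiff w
    rw [hw, mul_zero, sub_eq_zero] at h
    rw [hchar, hchar, h]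

theorem outcomeProb_eq_iff_weylChar_eq (ρ σ : State (FieldSpace N))
    {E : POVM (FieldSpace N) (EuclideanSpace ℝ (Fin 1))} {a : PhaseSpace N}
    {B : Matrix (Fin 1) (Fin 1) ℝ} {v : EuclideanSpace ℝ (Fin 1)}
    (hE : IsGaussian E (colMatrix a) B v) :
    (∀ X, MeasurableSet X → outcomeProb ρ E X = outcomeProb σ E X) ↔
      ∀ s : ℝ, ρ.weylChar (s • a) = σ.weylChar (s • a) := by
  rw [outcomeProb_eq_iff_trace_eq ρ σ E hE.charOp]
  have hcol (p : EuclideanSpace ℝ (Fin 1)) :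
      (WithLp.toLp 2 ((colMatrix a).mulVec p.ofLp) : PhaseSpace N) = p 0 • a := by
    ext k
    simp [colMatrix, Matrix.mulVec, dotProduct, mul_comm]
  simp only [trace_smul, hcol, mul_right_inj' (Complex.exp_ne_zero _)]
  constructor
  · intro h s
    simpa [State.weylChar] using h (WithLp.toLp 2 fun _ => s)
  · exact fun h p => h (p 0)

theorem weyl_zero : (weyl 0 : FieldSpace N →L[ℂ] FieldSpace N) = 1 := by
  have hq : (0 : PhaseSpace N).q = 0 := rfl
  have hp : (0 : PhaseSpace N).p = 0 := rfl
  ext1 f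
  rw [weyl_apply, hq, hp, inner_zero_left, Complex.ofReal_zero, mul_zero, Complex.exp_zero,
    one_smul]
  apply Lp.ext
  filter_upwards [coeFn_boost 0 (shift 0 f), coeFn_shift 0 f] with t h1 h2
  rw [h1, h2, wave, inner_zero_left, Complex.ofReal_zero, mul_zero, Complex.exp_zero, one_mul,
    sub_zero, one_apply_eq_self]

theorem informationallyComplete_of_dense {ι : Type*}
    {E : ι → POVM (FieldSpace N) (EuclideanSpace ℝ (Fin 1))}
    {a : ι → PhaseSpace N} {B : ι → Matrix (Fin 1) (Fin 1) ℝ}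
    {v : ι → EuclideanSpace ℝ (Fin 1)}
    (hE : ∀ j, IsGaussian (E j) (colMatrix (a j)) (B j) (v j))
    (hd : Dense {u : Metric.sphere (0 : PhaseSpace N) 1 |
      ∃ j, a j ≠ 0 ∧ ∃ ε : ℝ, (ε = 1 ∨ ε = -1) ∧ (u : PhaseSpace N) = (ε / ‖a j‖) • a j}) :
    InformationallyComplete E := by
  intro ρ σ h
  replace h (j) (s : ℝ) := (outcomeProb_eq_iff_weylChar_eq ρ σ (hE j)).1 (h j) s
  apply State.weylChar_injective
  have hne (x : PhaseSpace N) (hx : x ≠ 0) : ρ.weylChar x = σ.weylChar x := by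
    -- On the sphere of radius `‖x‖` both characteristic functions are continuous, and they agree in
    -- a dense set of directions.
    have hsphere :
        (fun u : Metric.sphere (0 : PhaseSpace N) 1 => ρ.weylChar (‖x‖ • (u : PhaseSpace N))) =
        fun u : Metric.sphere (0 : PhaseSpace N) 1 => σ.weylChar (‖x‖ • (u : PhaseSpace N)) := by
      have hρ := ρ.continuous_weylChar
      have hσ := σ.continuous_weylChar
      refine Continuous.ext_on hd (by fun_prop) (by fun_prop) ?_
      rintro u ⟨j, -, ε, -, hu⟩
      simp only [hu, smul_smul, h]
    have hx' : ‖x‖⁻¹ • x ∈ Metric.sphere (0 : PhaseSpace N) 1 := by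
      rw [mem_sphere_zero_iff_norm, norm_smul, norm_inv, norm_norm,
        inv_mul_cancel₀ (norm_ne_zero_iff.2 hx)]
    have := congrFun hsphere ⟨_, hx'⟩
    simpa [smul_smul, mul_inv_cancel₀ (norm_ne_zero_iff.2 hx)] using this
  funext x
  by_cases hx : x = 0
  · have hone (τ : State (FieldSpace N)) : τ.weylChar 0 = 1 := by
      rw [State.weylChar, weyl_zero, mul_one]
      exact τ.trace_one.tsum_eq
    rw [hx, hone, hone]
  · exact hne x hx

theorem dense_of_informationallyComplete {ι : Type*}
    {E : ι → POVM (FieldSpace N) (EuclideanSpace ℝ (Fin 1))}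
    {a : ι → PhaseSpace N} {B : ι → Matrix (Fin 1) (Fin 1) ℝ}
    {v : ι → EuclideanSpace ℝ (Fin 1)}
    (hE : ∀ j, IsGaussian (E j) (colMatrix (a j)) (B j) (v j))
    (hcomplete : InformationallyComplete E) :
    Dense {u : Metric.sphere (0 : PhaseSpace N) 1 |
      ∃ j, a j ≠ 0 ∧ ∃ ε : ℝ, (ε = 1 ∨ ε = -1) ∧ (u : PhaseSpace N) = (ε / ‖a j‖) • a j} := by
  set S := {u : Metric.sphere (0 : PhaseSpace N) 1 |
      ∃ j, a j ≠ 0 ∧ ∃ ε : ℝ, (ε = 1 ∨ ε = -1) ∧ (u : PhaseSpace N) = (ε / ‖a j‖) • a j} with hS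
  by_contra hnd
  obtain ⟨u₀, hu₀⟩ : ∃ u₀, u₀ ∉ closure S := by simpa [Dense] using hnd
  have hu₀ne : (u₀ : PhaseSpace N) ≠ 0 := ne_zero_of_mem_unit_sphere u₀
  obtain ⟨δ, hδ, hball⟩ : ∃ δ > 0, ∀ u ∈ S, δ ≤ dist u u₀ := by
    rw [Metric.mem_closure_iff] at hu₀
    push Not at hu₀
    obtain ⟨δ, hδ, h⟩ := hu₀
    exact ⟨δ, hδ, fun u hu => by rw [dist_comm]; exact h u hu⟩
  have hcont : ContinuousAt (fun x : PhaseSpace N => ‖x‖⁻¹ • x) u₀ :=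
    (continuousAt_id.norm.inv₀ (by simp)).smul continuousAt_id
  obtain ⟨r, hr, hrδ⟩ := Metric.continuousAt_iff.1 hcont δ hδ
  have hnorm₀ : ‖(u₀ : PhaseSpace N)‖ = 1 := norm_eq_of_mem_sphere u₀
  -- A point nearer to `u₀` would be nonzero, thanks to the bound `1`, and its normalization, an
  -- element of `S` with sign `s / |s|`, would be within `δ` of `u₀`.
  have hline (j) (s : ℝ) : min r 1 ≤ dist (s • a j) u₀ := by
    by_contra! hlt
    have hx0 : s • a j ≠ 0 := by
      intro h0
      rw [h0, dist_zero_left, hnorm₀] at hlt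
      exact absurd (hlt.trans_le (min_le_right _ _)) (lt_irrefl _)
    have hs : s ≠ 0 := fun h => hx0 (by rw [h, zero_smul])
    have ha : a j ≠ 0 := fun h => hx0 (by rw [h, smul_zero])
    have h1 := hrδ (hlt.trans_le (min_le_left _ _))
    rw [hnorm₀, inv_one, one_smul] at h1
    have hmem : ‖s • a j‖⁻¹ • s • a j ∈ Metric.sphere (0 : PhaseSpace N) 1 := by
      rw [mem_sphere_zero_iff_norm, norm_smul, norm_inv, norm_norm,
        inv_mul_cancel₀ (norm_ne_zero_iff.2 hx0)]
    refine absurd (hball ⟨_, hmem⟩ ⟨j, ha, s / |s|, ?_, ?_⟩) (not_le.2 h1)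
    · rcases lt_or_gt_of_ne hs with h | h
      · right; rw [abs_of_neg h, div_neg, div_self hs]
      · left; rw [abs_of_pos h, div_self hs]
    · simp only [norm_smul, Real.norm_eq_abs, smul_smul]
      congr 1
      field_simp
  have hpos : 0 < min r 1 := lt_min hr one_pos
  let f : ContDiffBump (u₀ : PhaseSpace N) := ⟨min r 1 / 2, min r 1, by positivity, by linarith⟩
  have hfc : HasCompactSupport fun x => (f x : ℂ) :=
    f.hasCompactSupport.comp_left (g := fun t : ℝ => (t : ℂ)) Complex.ofReal_zero
  have hfs : ContDiff ℝ (⊤ : ℕ∞) fun x => (f x : ℂ) := Complex.ofRealCLM.contDiff.comp f.contDiff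
  have hbapp (x) : hfc.toSchwartzMap hfs x = (f x : ℂ) := rfl
  have hfzero {x : PhaseSpace N} (hx : min r 1 ≤ dist x u₀) : f x = 0 := f.zero_of_le_dist hx
  obtain ⟨ρ, σ, hne, hρσ⟩ := exists_state_pair (hfc.toSchwartzMap hfs) (w₀ := u₀)
    (by rw [hbapp, hfzero, Complex.ofReal_zero]
        rw [dist_zero_left, hnorm₀]; exact min_le_right _ _)
    -- The bump is nonnegative, so its value at `-u₀` cannot cancel the value `1` at `u₀`.
    (by
      rw [hbapp, hbapp, Complex.conj_ofReal, ← Complex.ofReal_add, Ne, Complex.ofReal_eq_zero]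
      have h1 : f u₀ = 1 := f.one_of_mem_closedBall (Metric.mem_closedBall_self (by positivity))
      have h2 : 0 ≤ f (-u₀ : PhaseSpace N) := f.nonneg
      rw [h1]; positivity)
  refine hne (hcomplete ρ σ fun j => ?_)
  rw [outcomeProb_eq_iff_weylChar_eq ρ σ (hE j)]
  refine fun s => hρσ _ ?_
  rw [hbapp, hbapp, hfzero (hline j s), ← neg_smul, hfzero (hline j (-s))]
  simp

end Completeness

/-! ### Observables diagonalized by an isometry -/

section Diagonalization

variable {N : ℕ}

/-- Multiplication by the indicator function of a measurable set. -/
def indicatorOp (Y : Set (EuclideanSpace ℝ (Fin N))) (hY : MeasurableSet Y) :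
    FieldSpace N →L[ℂ] FieldSpace N :=
  LinearMap.mkContinuous
    { toFun := fun f => ((Lp.memLp f).indicator hY).toLp _
      map_add' := by
        intro f g
        rw [← MemLp.toLp_add]
        refine MemLp.toLp_congr _ _ ?_
        filter_upwards [Lp.coeFn_add f g] with t ht
        by_cases h : t ∈ Y
        · simp only [Pi.add_apply, Set.indicator_of_mem h, ht]
        · simp only [Pi.add_apply, Set.indicator_of_notMem h, add_zero]
      map_smul' := by
        intro c f
        rw [RingHom.id_apply, ← MemLp.toLp_const_smul]
        refine MemLp.toLp_congr _ _ ?_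
        filter_upwards [Lp.coeFn_smul c f] with t ht
        by_cases h : t ∈ Y
        · simp only [Pi.smul_apply, Set.indicator_of_mem h, ht]
        · simp only [Pi.smul_apply, Set.indicator_of_notMem h, smul_zero] }
    1
    (by
      intro f
      rw [one_mul]
      refine Lp.norm_le_norm_of_ae_le ?_
      filter_upwards [((Lp.memLp f).indicator hY).coeFn_toLp] with t ht
      simp only [LinearMap.coe_mk, AddHom.coe_mk]
      rw [ht]
      exact norm_indicator_le_norm_self _ _)

theorem inner_indicatorOp {Y : Set (EuclideanSpace ℝ (Fin N))} (hY : MeasurableSet Y)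
    (f g : FieldSpace N) :
    inner ℂ f (indicatorOp Y hY g) = ∫ t in Y, starRingEnd ℂ (f t) * g t := by
  rw [inner_eq_integral, ← integral_indicator hY]
  refine integral_congr_ae ?_
  have h : indicatorOp Y hY g =ᵐ[volume] Y.indicator g := ((Lp.memLp g).indicator hY).coeFn_toLp
  filter_upwards [h] with t ht
  rw [ht]
  by_cases h : t ∈ Y <;> simp [h]

variable (V : FieldSpace N →ₗᵢ[ℂ] FieldSpace N)
  {m : EuclideanSpace ℝ (Fin N) → EuclideanSpace ℝ (Fin N)} (hm : Measurable m)

open Classical in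
/-- The effects of the observable diagonalized by the isometry `V`, with values `m`. -/
def diagEffect (X : Set (EuclideanSpace ℝ (Fin N))) : FieldSpace N →L[ℂ] FieldSpace N :=
  if hX : MeasurableSet X then
    ContinuousLinearMap.adjoint V.toContinuousLinearMap *
      (indicatorOp (m ⁻¹' X) (hm hX) * V.toContinuousLinearMap)
  else 0

theorem inner_diagEffect {X : Set (EuclideanSpace ℝ (Fin N))} (hX : MeasurableSet X)
    (φ ψ : FieldSpace N) :
    inner ℂ φ (diagEffect V hm X ψ) = ∫ t in m ⁻¹' X, starRingEnd ℂ (V φ t) * V ψ t := by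
  rw [diagEffect, dif_pos hX, mul_apply_eq_comp,
    ContinuousLinearMap.adjoint_inner_right]
  exact inner_indicatorOp (hm hX) _ _

theorem inner_diagEffect_self {X : Set (EuclideanSpace ℝ (Fin N))} (hX : MeasurableSet X)
    (ψ : FieldSpace N) :
    inner ℂ ψ (diagEffect V hm X ψ) = ((∫ t in m ⁻¹' X, ‖V ψ t‖ ^ 2 : ℝ) : ℂ) := by
  rw [inner_diagEffect V hm hX, ← integral_complex_ofReal]
  congr 1
  funext t
  rw [← Complex.normSq_eq_conj_mul_self, Complex.normSq_eq_norm_sq]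

/-- The observable diagonalized by the isometry `V`, with values `m`. -/
def diagPOVM : POVM (FieldSpace N) (EuclideanSpace ℝ (Fin N)) where
  toFun := diagEffect V hm
  pos := by
    intro X hX
    rw [ContinuousLinearMap.isPositive_iff_complex]
    intro ψ
    rw [← inner_conj_symm, inner_diagEffect_self V hm hX, Complex.conj_ofReal]
    exact ⟨rfl, integral_nonneg fun z => sq_nonneg _⟩
  univ := by
    ext1 ψ
    refine ext_inner_left ℂ fun φ => ?_
    rw [inner_diagEffect V hm MeasurableSet.univ, Set.preimage_univ, Measure.restrict_univ,
      ← inner_eq_integral, V.inner_map_map]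
    rfl
  sigma_additive := by
    intro X hX hd φ ψ
    rw [inner_diagEffect V hm (MeasurableSet.iUnion hX), Set.preimage_iUnion]
    simp only [inner_diagEffect V hm (hX _)]
    exact hasSum_integral_iUnion (fun n => hm (hX n)) (fun i j hij => (hd hij).preimage m)
      (integrable_conj_mul _ _).integrableOn

theorem diagMeasure_diagPOVM (ψ : FieldSpace N) :
    (diagPOVM V hm).diagMeasure ψ =
      (volume.withDensity fun t => ENNReal.ofReal (‖V ψ t‖ ^ 2)).map m := by
  have hint : Integrable fun t => ‖V ψ t‖ ^ 2 :=
    (memLp_two_iff_integrable_sq_norm (Lp.aestronglyMeasurable _)).1 (Lp.memLp (V ψ))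
  ext X hX
  rw [POVM.diagMeasure_apply _ _ hX, Measure.map_apply hm hX, withDensity_apply _ (hm hX),
    ← ofReal_integral_eq_lintegral_ofReal hint.integrableOn
      (Filter.Eventually.of_forall fun _ => sq_nonneg _)]
  congr 1
  exact congrArg Complex.re (inner_diagEffect_self V hm hX ψ)

/-- The outcome distribution in `ψ` is the image of `|V ψ|²` under scaling by `κ`. Its
characteristic function is therefore `⟨V ψ, boost (κ p) (V ψ)⟩`, and `V` can be removed because it
is isometric. -/
theorem hasCharOp_diagPOVM (κ : ℝ) {p : EuclideanSpace ℝ (Fin N)}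
    {T : FieldSpace N →L[ℂ] FieldSpace N} (hT : ∀ f, V (T f) = boost (κ • p) (V f)) :
    (diagPOVM V (m := fun t => κ • t) (by fun_prop)).HasCharOp p T := by
  intro ψ
  rw [diagMeasure_diagPOVM, charFun_apply, integral_map (by fun_prop)
    (Continuous.aestronglyMeasurable (by fun_prop)), integral_withDensity_ofReal
      ((Lp.stronglyMeasurable (V ψ)).norm.measurable.pow_const 2) (fun _ => sq_nonneg _),
    ← V.inner_map_map, hT, inner_boost]
  refine integral_congr_ae (Filter.Eventually.of_forall fun t => ?_)
  simp only [← Complex.normSq_eq_conj_mul_self, Complex.normSq_eq_norm_sq, wave,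
    real_inner_smul_left, real_inner_comm p t]
  rw [mul_comm]
  congr 2
  rw [mul_comm]

end Diagonalization

/-! ### Existence of the rotated quadratures -/

section Quadrature

variable {N : ℕ}

open FourierTransform in
theorem fourier_shift (q : EuclideanSpace ℝ (Fin N)) (f : FieldSpace N) :
    𝓕 (shift q f) = boost (-(2 * Real.pi) • q) (𝓕 f) := by
  have hF : Continuous (𝓕 : FieldSpace N → FieldSpace N) :=
    (Lp.fourierTransformₗᵢ (EuclideanSpace ℝ (Fin N)) ℂ).continuous
  have hd := SchwartzMap.denseRange_toLpCLM (E := EuclideanSpace ℝ (Fin N)) (F := ℂ) (p := 2)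
    (μ := volume) ENNReal.ofNat_ne_top
  have h1 : Continuous fun f : FieldSpace N => 𝓕 (shift q f) := by fun_prop
  have h2 : Continuous fun f : FieldSpace N => boost (-(2 * Real.pi) • q) (𝓕 f) := by fun_prop
  -- Both sides are continuous in `f`, so Schwartz functions suffice; there the claim is a
  -- translation of the variable.
  refine congrFun (hd.equalizer h1 h2 (funext fun g => ?_)) f
  simp only [Function.comp_apply, SchwartzMap.toLpCLM_apply]
  have hshift : shift q (g.toLp 2) = (g.compSubConstCLM ℂ q).toLp 2 := by
    apply Lp.ext
    filter_upwards [coeFn_shift q (g.toLp 2), ae_comp_sub (g.coeFn_toLp 2 volume) q,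
      (g.compSubConstCLM ℂ q).coeFn_toLp 2 volume] with t h1 h2 h3
    rw [h1, h2, h3, SchwartzMap.compSubConstCLM_apply]
  rw [hshift, SchwartzMap.toLp_fourier_eq, SchwartzMap.toLp_fourier_eq]
  apply Lp.ext
  filter_upwards [(𝓕 (g.compSubConstCLM ℂ q)).coeFn_toLp 2 volume,
    (𝓕 g).coeFn_toLp 2 volume, coeFn_boost (-(2 * Real.pi) • q) ((𝓕 g).toLp 2)] with w h1 h2 h3
  rw [h1, h3, h2, SchwartzMap.fourier_coe, SchwartzMap.fourier_coe, Real.fourier_eq',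
    Real.fourier_eq', ← integral_const_mul, ← integral_add_right_eq_self _ q]
  refine integral_congr_ae (Filter.Eventually.of_forall fun t => ?_)
  simp only [SchwartzMap.compSubConstCLM_apply, smul_eq_mul, wave]
  rw [← mul_assoc, ← Complex.exp_add, inner_add_left, real_inner_smul_left,
    add_sub_cancel_right]
  congr 2
  push_cast
  ring

/-- The chirp `t ↦ exp(i α |t|²)`. -/
def chirp (α : ℝ) (t : EuclideanSpace ℝ (Fin N)) : ℂ :=
  Complex.exp ((α * ‖t‖ ^ 2 : ℝ) * Complex.I)

theorem norm_chirp (α : ℝ) (t : EuclideanSpace ℝ (Fin N)) : ‖chirp α t‖ = 1 :=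
  Complex.norm_exp_ofReal_mul_I _

theorem memLp_chirp_mul (α : ℝ) (f : FieldSpace N) :
    MemLp (fun t => chirp α t * f t) 2 volume := by
  refine (Lp.memLp f).of_le (AEStronglyMeasurable.mul ?_ (Lp.aestronglyMeasurable f)) ?_
  · have : Continuous (chirp (N := N) α) := by unfold chirp; fun_prop
    exact this.aestronglyMeasurable
  · exact Filter.Eventually.of_forall fun t => by rw [norm_mul, norm_chirp, one_mul]

/-- Multiplication by the chirp, `exp(i α |Q|²)`. -/
def chirpOp (α : ℝ) : FieldSpace N →ₗᵢ[ℂ] FieldSpace N where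
  toFun := fun f => (memLp_chirp_mul α f).toLp _
  map_add' := by
    intro f g
    rw [← MemLp.toLp_add]
    refine MemLp.toLp_congr _ _ ?_
    filter_upwards [Lp.coeFn_add f g] with t ht
    simp only [ht, Pi.add_apply, mul_add]
  map_smul' := by
    intro c f
    rw [RingHom.id_apply, ← MemLp.toLp_const_smul]
    refine MemLp.toLp_congr _ _ ?_
    filter_upwards [Lp.coeFn_smul c f] with t ht
    simp only [ht, Pi.smul_apply, smul_eq_mul, mul_left_comm]
  norm_map' := by
    intro f
    rw [LinearMap.coe_mk, AddHom.coe_mk, Lp.norm_toLp, Lp.norm_def]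
    congr 1
    refine eLpNorm_congr_norm_ae (Filter.Eventually.of_forall fun t => ?_)
    rw [norm_mul, norm_chirp, one_mul]

theorem coeFn_chirpOp (α : ℝ) (f : FieldSpace N) :
    chirpOp α f =ᵐ[volume] fun t => chirp α t * f t :=
  (memLp_chirp_mul α f).coeFn_toLp

/-- Under `hx` the chirp, the plane wave and the Weyl phase complete the square: their exponents sum
to `i α |t - q|²`, which is the chirp translated by `q`. -/
theorem chirpOp_weyl (α : ℝ) {x : PhaseSpace N} (hx : x.p = -(2 * α) • x.q) (f : FieldSpace N) :
    chirpOp α (weyl x f) = shift x.q (chirpOp α f) := by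
  apply Lp.ext
  rw [weyl_apply]
  filter_upwards [coeFn_chirpOp α (Complex.exp (-(Complex.I / 2) * (inner ℝ x.q x.p : ℝ)) •
      boost x.p (shift x.q f)), coeFn_shift x.q (chirpOp α f), ae_comp_sub (coeFn_chirpOp α f) x.q,
    Lp.coeFn_smul (Complex.exp (-(Complex.I / 2) * (inner ℝ x.q x.p : ℝ)))
      (boost x.p (shift x.q f)), coeFn_boost x.p (shift x.q f), coeFn_shift x.q f]
    with t h1 h2 h3 h4 h5 h6
  rw [h1, h4, Pi.smul_apply, h5, h6, h2, h3, smul_eq_mul, wave, chirp, chirp, ← mul_assoc,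
    ← mul_assoc, ← Complex.exp_add, ← Complex.exp_add, norm_sub_sq_real, hx, real_inner_smul_right,
    real_inner_smul_left, real_inner_self_eq_norm_sq, real_inner_comm]
  congr 2
  push_cast
  ring

theorem shift_zero (f : FieldSpace N) : shift 0 f = f := by
  apply Lp.ext
  filter_upwards [coeFn_shift 0 f] with t ht
  rw [ht, sub_zero]

open scoped ComplexOrder in
theorem exists_isRotatedQuadrature (θ : ℝ) : ∃ Q, IsRotatedQuadrature θ Q := by
  -- The symplectic form vanishes on the diagonal, so a single quadrature may have zero noise.
  have hpsd : ((0 : Matrix (Fin 1) (Fin 1) ℝ).map (fun r => (r : ℂ)) - Complex.I •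
      ((colMatrix (quadratureVector θ)).transpose * symplecticMatrix 1 *
        colMatrix (quadratureVector θ)).map (fun r => (r : ℂ))) = 0 := by
    ext i j
    simp [Matrix.mul_apply, Fintype.sum_prod_type, Fin.sum_univ_two, symplecticMatrix, colMatrix,
      quadratureVector]
    ring
  have hq (p : EuclideanSpace ℝ (Fin 1)) :
      PhaseSpace.q (WithLp.toLp 2 ((colMatrix (quadratureVector θ)).mulVec p.ofLp)) =
        -Real.sin θ • p := by
    ext i; fin_cases i
    simp [PhaseSpace.q, colMatrix, Matrix.mulVec, dotProduct, quadratureVector]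
  have hp (p : EuclideanSpace ℝ (Fin 1)) :
      PhaseSpace.p (WithLp.toLp 2 ((colMatrix (quadratureVector θ)).mulVec p.ofLp)) =
        Real.cos θ • p := by
    ext i; fin_cases i
    simp [PhaseSpace.p, colMatrix, Matrix.mulVec, dotProduct, quadratureVector]
  suffices h : ∃ (V : FieldSpace 1 →ₗᵢ[ℂ] FieldSpace 1) (κ : ℝ),
      ∀ (p : EuclideanSpace ℝ (Fin 1)) (f : FieldSpace 1),
        V (weyl (WithLp.toLp 2 ((colMatrix (quadratureVector θ)).mulVec p.ofLp)) f) =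
          boost (κ • p) (V f) by
    obtain ⟨V, κ, hV⟩ := h
    refine ⟨diagPOVM V (m := fun t => κ • t) (by fun_prop), ?_, fun p => ?_⟩
    · rw [hpsd]; exact Matrix.PosSemidef.zero
    · simpa using hasCharOp_diagPOVM V κ (hV p)
  by_cases hs : Real.sin θ = 0
  · refine ⟨LinearIsometry.id, Real.cos θ, fun p f => ?_⟩
    rw [LinearIsometry.id_apply, LinearIsometry.id_apply, weyl_apply, hp, hq, hs, neg_zero,
      zero_smul, shift_zero, inner_zero_left, Complex.ofReal_zero, mul_zero, Complex.exp_zero,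
      one_smul]
  -- The chirp parameter solves `cos θ = -(2 α) (-sin θ)`, so the Weyl operator becomes the shift by
  -- `-sin θ p`. The Fourier transform turns this into the boost by `2π sin θ p`.
  · refine ⟨(Lp.fourierTransformₗᵢ (EuclideanSpace ℝ (Fin 1)) ℂ).toLinearIsometry.comp
      (chirpOp (Real.cos θ / (2 * Real.sin θ))), 2 * Real.pi * Real.sin θ, fun p f => ?_⟩
    have h := fourier_shift (-Real.sin θ • p) (chirpOp (Real.cos θ / (2 * Real.sin θ)) f)
    rw [smul_smul, neg_mul_neg] at h
    have hc : chirpOp (Real.cos θ / (2 * Real.sin θ))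
        (weyl (WithLp.toLp 2 ((colMatrix (quadratureVector θ)).mulVec p.ofLp)) f) =
        shift (-Real.sin θ • p) (chirpOp (Real.cos θ / (2 * Real.sin θ)) f) := by
      rw [chirpOp_weyl, hq]
      rw [hp, hq, smul_smul]
      congr 1
      field_simp
    rw [← hc] at h
    exact h

end Quadrature

/-! ### Density on the circle and density of angles -/

section Circle

theorem norm_quadratureVector (θ : ℝ) : ‖quadratureVector θ‖ = 1 := by
  rw [EuclideanSpace.norm_eq, Real.sqrt_eq_one]
  simp [Fintype.sum_prod_type, quadratureVector]

theorem continuous_quadratureVector : Continuous quadratureVector := by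
  unfold quadratureVector
  refine (PiLp.continuous_toLp 2 _).comp (continuous_pi fun k => ?_)
  obtain ⟨i, j⟩ := k
  fin_cases j
  · exact Real.continuous_sin.neg
  · exact Real.continuous_cos

theorem exists_eq_quadratureVector (u : Metric.sphere (0 : PhaseSpace 1) 1) :
    ∃ θ, (u : PhaseSpace 1) = quadratureVector θ := by
  have hu : ‖(u : PhaseSpace 1)‖ = 1 := norm_eq_of_mem_sphere u
  rw [EuclideanSpace.norm_eq, Real.sqrt_eq_one] at hu
  simp only [Fintype.sum_prod_type, Fin.sum_univ_two, Fin.sum_univ_one, Real.norm_eq_abs,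
    sq_abs] at hu
  -- If `u = (-sin θ, cos θ)` then `z = exp(i θ)`, so `θ` is the argument of `z`.
  set z : ℂ := ⟨(u : PhaseSpace 1) (0, 1), -(u : PhaseSpace 1) (0, 0)⟩ with hz
  have hnorm : ‖z‖ = 1 := by
    rw [Complex.norm_def, Real.sqrt_eq_one, Complex.normSq_apply]
    simp only [hz]
    linarith
  have hsin : Real.sin z.arg = -(u : PhaseSpace 1) (0, 0) := by
    rw [Complex.sin_arg, hnorm, div_one]
  have hcos : Real.cos z.arg = (u : PhaseSpace 1) (0, 1) := by
    rw [Complex.cos_arg (norm_ne_zero_iff.1 (hnorm ▸ one_ne_zero)), hnorm, div_one]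
  refine ⟨z.arg, ?_⟩
  ext ⟨i, j⟩
  fin_cases i
  fin_cases j
  · simp [quadratureVector, hsin]
  · simp [quadratureVector, hcos]

theorem quadratureVector_sub_int_mul_pi (θ : ℝ) (n : ℤ) :
    ∃ ε : ℝ, (ε = 1 ∨ ε = -1) ∧
      quadratureVector θ = ε • quadratureVector (θ - n * Real.pi) := by
  refine ⟨(-1) ^ n, ?_, ?_⟩
  · rcases Int.even_or_odd n with h | h
    · left; exact h.neg_one_zpow
    · right; exact h.neg_one_zpow
  · have h1 : ((-1 : ℝ) ^ n) * (-1) ^ n = 1 := by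
      rw [← mul_zpow]; simp
    ext ⟨i, j⟩
    fin_cases j
    · simp [quadratureVector, Real.sin_sub_int_mul_pi, ← mul_assoc, h1]
    · simp [quadratureVector, Real.cos_sub_int_mul_pi, ← mul_assoc, h1]

theorem dense_quadratureVector_iff {I : Set ℝ} (hI : I ⊆ Set.Ico 0 Real.pi) :
    Dense {u : Metric.sphere (0 : PhaseSpace 1) 1 |
      ∃ θ : I, quadratureVector θ ≠ 0 ∧ ∃ ε : ℝ, (ε = 1 ∨ ε = -1) ∧
        (u : PhaseSpace 1) = (ε / ‖quadratureVector θ‖) • quadratureVector θ} ↔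
      Set.Ico 0 Real.pi ⊆ closure I := by
  have hne (θ : ℝ) : quadratureVector θ ≠ 0 := by
    rw [← norm_ne_zero_iff, norm_quadratureVector]; exact one_ne_zero
  simp only [norm_quadratureVector, div_one, ne_eq, hne, not_false_eq_true, true_and]
  have hmem {ε : ℝ} (hε : ε = 1 ∨ ε = -1) (θ : ℝ) :
      ε • quadratureVector θ ∈ Metric.sphere (0 : PhaseSpace 1) 1 := by
    rw [mem_sphere_zero_iff_norm, norm_smul, norm_quadratureVector]
    rcases hε with rfl | rfl <;> simp
  constructor
  · intro hd
    -- The endpoint is left to the closure: `0` and `π` give opposite vectors, and `closure I` may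
    -- contain `π`. For `θ₀` in the open interval, `|θ - θ₀| < π`.
    suffices h : Set.Ioo 0 Real.pi ⊆ closure I by
      have hcl := closure_minimal h isClosed_closure
      rw [closure_Ioo Real.pi_pos.ne] at hcl
      exact Set.Ico_subset_Icc_self.trans hcl
    intro θ₀ hθ₀
    have hIcc : closure I ⊆ Set.Icc 0 Real.pi :=
      closure_minimal (hI.trans Set.Ico_subset_Icc_self) isClosed_Icc
    have hcomp : IsCompact (closure I) := isCompact_Icc.of_isClosed_subset isClosed_closure hIcc
    -- The vectors with angles in `closure I`, up to sign, form a compact and hence closed set;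
    -- containing a dense set of directions, it is the whole circle.
    have hK : IsCompact ((fun x : ℝ × ℝ => x.1 • quadratureVector x.2) ''
        (({1, -1} : Set ℝ) ×ˢ closure I)) :=
      ((Set.toFinite _).isCompact.prod hcomp).image
        (continuous_fst.smul (continuous_quadratureVector.comp continuous_snd))
    have hclosed : IsClosed {u : Metric.sphere (0 : PhaseSpace 1) 1 | (u : PhaseSpace 1) ∈
        (fun x : ℝ × ℝ => x.1 • quadratureVector x.2) '' (({1, -1} : Set ℝ) ×ˢ closure I)} :=
      hK.isClosed.preimage continuous_subtype_val
    have hall := closure_minimal (s := {u : Metric.sphere (0 : PhaseSpace 1) 1 |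
      ∃ θ : I, ∃ ε : ℝ, (ε = 1 ∨ ε = -1) ∧ (u : PhaseSpace 1) = ε • quadratureVector θ})
      (by
        rintro u ⟨θ, ε, hε, hu⟩
        exact ⟨(ε, θ), ⟨by simpa using hε, subset_closure θ.2⟩, hu.symm⟩) hclosed
    rw [hd.closure_eq] at hall
    have h1 := hmem (Or.inl rfl : (1 : ℝ) = 1 ∨ (1 : ℝ) = -1) θ₀
    obtain ⟨⟨ε, θ⟩, ⟨-, hθ⟩, heq⟩ := hall (Set.mem_univ ⟨_, h1⟩)
    simp only [one_smul] at heq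
    have e0 := congrArg (fun x : PhaseSpace 1 => x (0, 0)) heq
    have e1 := congrArg (fun x : PhaseSpace 1 => x (0, 1)) heq
    simp [quadratureVector] at e0 e1
    have hsin : Real.sin (θ - θ₀) = 0 := by
      rw [Real.sin_sub, ← e0, ← e1]; ring
    have hb := hIcc hθ
    rw [Real.sin_eq_zero_iff_of_lt_of_lt (by linarith [hb.1, hθ₀.2]) (by linarith [hb.2, hθ₀.1]),
      sub_eq_zero] at hsin
    rwa [← hsin]
  · intro hcl u
    obtain ⟨θ', hθ'⟩ := exists_eq_quadratureVector u
    -- Subtracting this multiple of `π` brings the angle into `[0, π)`; the sign `ε` absorbs the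
    -- change.
    obtain ⟨ε, hε, heq⟩ := quadratureVector_sub_int_mul_pi θ' ⌊θ' / Real.pi⌋
    have hθ : θ' - ⌊θ' / Real.pi⌋ * Real.pi ∈ Set.Ico 0 Real.pi := by
      have h1 := Int.floor_le (θ' / Real.pi)
      have h2 := Int.lt_floor_add_one (θ' / Real.pi)
      rw [le_div_iff₀ Real.pi_pos] at h1
      rw [div_lt_iff₀ Real.pi_pos] at h2
      constructor <;> linarith
    let F : ℝ → Metric.sphere (0 : PhaseSpace 1) 1 := fun θ => ⟨ε • quadratureVector θ, hmem hε θ⟩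
    have hF : Continuous F := (continuous_quadratureVector.const_smul ε).subtype_mk _
    have hu : u = F (θ' - ⌊θ' / Real.pi⌋ * Real.pi) := Subtype.ext (hθ'.trans heq)
    rw [hu]
    refine closure_mono ?_ (image_closure_subset_closure_image hF ⟨_, hcl hθ, rfl⟩)
    rintro _ ⟨θ, hθI, rfl⟩
    exact ⟨⟨θ, hθI⟩, ε, hε, rfl⟩

end Circle

end GaussianObs

end

/-! ### The main theorem -/

open GaussianObs
theorem mainTheorem7 :
    (∀ (N : ℕ) (ι : Type*) (E : ι → POVM (FieldSpace N) (EuclideanSpace ℝ (Fin 1)))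
      (a : ι → PhaseSpace N) (B : ι → Matrix (Fin 1) (Fin 1) ℝ)
      (v : ι → EuclideanSpace ℝ (Fin 1)),
      (∀ j, IsGaussian (E j) (colMatrix (a j)) (B j) (v j)) →
      (InformationallyComplete E ↔
        Dense {u : Metric.sphere (0 : PhaseSpace N) 1 |
          ∃ j, a j ≠ 0 ∧ ∃ ε : ℝ, (ε = 1 ∨ ε = -1) ∧
            (u : PhaseSpace N) = (ε / ‖a j‖) • a j})) ∧
    (∀ θ : ℝ, ∃ Q, IsRotatedQuadrature θ Q) ∧
    (∀ (I : Set ℝ), I ⊆ Set.Ico 0 Real.pi →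
      ∀ Q : I → POVM (FieldSpace 1) (EuclideanSpace ℝ (Fin 1)),
        (∀ θ : I, IsRotatedQuadrature θ (Q θ)) →
        (InformationallyComplete Q ↔ Set.Ico 0 Real.pi ⊆ closure I)) := by
  refine ⟨fun N ι E a B v hE => ⟨dense_of_informationallyComplete hE,
    informationallyComplete_of_dense hE⟩, exists_isRotatedQuadrature, fun I hI Q hQ => ?_⟩
  rw [← dense_quadratureVector_iff hI]
  exact ⟨dense_of_informationallyComplete (a := fun θ : I => quadratureVector θ) (B := fun _ => 0)
    (v := fun _ => 0) hQ, informationallyComplete_of_dense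
      (a := fun θ : I => quadratureVector θ) (B := fun _ => 0) (v := fun _ => 0) hQ⟩
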